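/- **Setting.** Let $d\ge 1$, $n\in\mathbb N$, $\varepsilon=1/n$, $D=(0,1)^d$, and let $H^1_{\rm per}(D)$ be the space of real $\mathbb Z^d$-periodic functions that are, together with their weak gradient, square integrable on $D$. Let $\mathbb R^d$ be partitioned into the closed cubes $\varepsilon(q+[0,1]^d)$, $q\in\mathbb Z^d$. A *$j$-domino block* is a cuboid consisting of such cubes that is composed of an $\alpha$-cube $B_\alpha$ and an adjacent $\beta$-cube (in any of the $2d$ directions), both of side length $\varepsilon j$. Let $\mathcal B$ be any $\mathbb Z^d$-periodic non-overlapping tiling of $\mathbb R^d$ by domino blocks with $1\le j\le L$ (i.e. any realization of a random domino block configuration on the torus), let $0\le\alpha\le\beta$, and let $V=\alpha$ on all $\alpha$-cubes and $V=\beta$ elsewhere. Put $\|w\|^2=\int_D w^2$ and $|\!|\!|u|\!|\!|^2=\int_D|\nabla u|^2+Vu^2$. Assume $\beta\ge c_\beta\,\varepsilon^{-2}$ with $c_\beta>0$. **Mesh and finite element space.** Fix an integer $1<\tilde\ell<L$ and let $D_{\alpha,>\tilde\ell}$ be the union of the closed cubes $B_\alpha$ over all $j$-blocks with $j>\tilde\ell$.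 Let $D_{\alpha,>\tilde\ell}$ carry a periodic uniform Cartesian mesh: each such $B_\alpha$ is divided into congruent cubes of side length $h_B$ with $\varepsilon\le h_B\le c_{\rm mesh}\,\varepsilon\tilde\ell$ (for instance $h_B=\varepsilon j/(\lfloor j/\tilde\ell\rfloor+1)$), and if two such closed cubes touch, their meshes belong to one and the same uniform grid. The mesh is extended by one layer of elements of width $\varepsilon/2$, and $\mathcal W_{\tilde\ell}$ is the $Q_1$ space on the extended mesh with homogeneous Dirichlet conditions on its outer boundary: a function of $\mathcal W_{\tilde\ell}$ is continuous and $Q_1$ on the mesh of $D_{\alpha,>\tilde\ell}$; in the layer it is the piecewise multilinear interpolant, on the tensor grid formed by the mesh lines and the lines at distance $\varepsilon/2$ from them, of its values on $D_{\alpha,>\tilde\ell}$ and of the value $0$ at grid points outside; it vanishes elsewhere. **Projection.** For every mesh node $z$ in $D_{\alpha,>\tilde\ell}$ choose (periodically) a set $\sigma_z\ni z$ that is a mesh cell contained in $D_{\alpha,>\tilde\ell}$ or a $(d-1)$-dimensional face of such a cell. The Scott–Zhang interpolant $I^{\rm sz}u$ of $u\in H^1_{\rm per}(D)$ is the $Q_1$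 function on the mesh of $D_{\alpha,>\tilde\ell}$ with nodal values $\int_{\sigma_z}\psi_z u$, where $\psi_z\in Q_1(\sigma_z)$ is $L^2(\sigma_z)$-dual to the nodal basis function of $z$ (on faces, $u$ is understood in the sense of traces). $\Pi_{\tilde\ell}u$ is the unique element of $\mathcal W_{\tilde\ell}$ with $\Pi_{\tilde\ell}u=I^{\rm sz}u$ on $D_{\alpha,>\tilde\ell}$. **Claim.** There is a constant $C>0$ depending only on $d$, $c_\beta$ and $c_{\rm mesh}$ (and not on $\varepsilon,\alpha,\beta,L,\tilde\ell$, the configuration $\mathcal B$, the mesh, the choice of the $\sigma_z$, or $u$) such that for all $u\in H^1_{\rm per}(D)$ the function $u-\Pi_{\tilde\ell}u$ is in $L^2(D)$ and $$\|u-\Pi_{\tilde\ell}u\|\le C\,\varepsilon\tilde\ell\,|\!|\!|u|\!|\!| .$$ -/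

import Mathlib

open MeasureTheory
open scoped ContDiff

noncomputable section

namespace Domino

/-- The side length `ε = 1 / n` of the elements of the background partition. -/
def eps (n : ℕ) : ℝ := 1 / (n : ℝ)

/-- The vector of `ℝᵈ` with integer entries `m`. -/
def intVec {d : ℕ} (m : Fin d → ℤ) : Fin d → ℝ := fun k => (m k : ℝ)

/-- The unit cube `D = (0,1)ᵈ`. -/
def unitCube (d : ℕ) : Set (Fin d → ℝ) := Set.univ.pi fun _ => Set.Ioo 0 1

/-! ### Periodic Sobolev functions and norms -/

/-- `u` belongs to `H¹_per(D)` and `g` is its weak gradient: `u` and `g` are (identified with their)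
`ℤᵈ`-periodic extensions to `ℝᵈ`, are square integrable on `D`, and `g k` is the weak `k`-th partial
derivative of `u` on `ℝᵈ`. -/
structure IsH1Per {d : ℕ} (u : (Fin d → ℝ) → ℝ) (g : Fin d → (Fin d → ℝ) → ℝ) : Prop where
  periodic : ∀ (m : Fin d → ℤ) (x : Fin d → ℝ), u (x + intVec m) = u x
  periodic_grad : ∀ (k : Fin d) (m : Fin d → ℤ) (x : Fin d → ℝ), g k (x + intVec m) = g k x
  memLp : MemLp u 2 (volume.restrict (unitCube d))
  memLp_grad : ∀ k, MemLp (g k) 2 (volume.restrict (unitCube d))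
  weak_deriv : ∀ (k : Fin d) (φ : (Fin d → ℝ) → ℝ), ContDiff ℝ ∞ φ → HasCompactSupport φ →
    ∫ x, u x * fderiv ℝ φ x (Pi.single k 1) = - ∫ x, g k x * φ x

/-- The norm of `L²(D)`. -/
def l2Norm {d : ℕ} (w : (Fin d → ℝ) → ℝ) : ℝ := √(∫ x in unitCube d, w x ^ 2)

/-- The energy norm `(‖∇u‖² + (V u, u))^{1/2}`, where `g = ∇u`. -/
def energyNorm {d : ℕ} (V u : (Fin d → ℝ) → ℝ) (g : Fin d → (Fin d → ℝ) → ℝ) : ℝ :=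
  √(∫ x in unitCube d, ((∑ k, g k x ^ 2) + V x * u x ^ 2))

/-! ### Domino blocks -/

/-- A domino block, in units of `ε`: two adjacent lattice cubes of side length `size`.
The `α`-cube has lower corner `corner`; the `β`-cube is its neighbour in direction `axis`,
on the upper side if `up = true` and on the lower side otherwise. -/
structure Block (d : ℕ) where
  size : ℕ
  corner : Fin d → ℤ
  axis : Fin d
  up : Bool

namespace Block

variable {d : ℕ}

/-- Lower corner of the `β`-cube. -/
def betaCorner (B : Block d) : Fin d → ℤ :=
  B.corner + Pi.single B.axis (if B.up then (B.size : ℤ) else -(B.size : ℤ))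

/-- The unit cells `q + [0,1]ᵈ` of which the `α`-cube consists. -/
def alphaCells (B : Block d) : Set (Fin d → ℤ) :=
  {q | ∀ k, B.corner k ≤ q k ∧ q k < B.corner k + B.size}

/-- The unit cells `q + [0,1]ᵈ` of which the `β`-cube consists. -/
def betaCells (B : Block d) : Set (Fin d → ℤ) :=
  {q | ∀ k, B.betaCorner k ≤ q k ∧ q k < B.betaCorner k + B.size}

/-- Translation by `n • m` in units of `ε = 1 / n`, that is, by the integer vector `m`. -/
def shift (n : ℕ) (m : Fin d → ℤ) (B : Block d) : Block d :=
  { B with corner := fun k => B.corner k + n * m k }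

/-- The closed `r`-neighbourhood (in the maximum norm) of the `α`-cube in `ℝᵈ`;
for `r = 0` this is the `α`-cube `B_α` itself. -/
def alphaCube (n : ℕ) (r : ℝ) (B : Block d) : Set (Fin d → ℝ) :=
  {x | ∀ k, eps n * B.corner k - r ≤ x k ∧ x k ≤ eps n * (B.corner k + B.size) + r}

end Block

/-- `𝓑` is a domino block configuration on the torus `ℝᵈ/ℤᵈ` with blocks of sizes between `1` and `L`,
described by its periodic extension: `𝓑` is invariant under integer translations and every element
`ε (q + [0,1]ᵈ)` of the background partition of `ℝᵈ` belongs to exactly one block of `𝓑`. -/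
structure IsTiling {d : ℕ} (n L : ℕ) (𝓑 : Set (Block d)) : Prop where
  size_mem : ∀ B ∈ 𝓑, 1 ≤ B.size ∧ B.size ≤ L
  shift_mem : ∀ B ∈ 𝓑, ∀ m : Fin d → ℤ, B.shift n m ∈ 𝓑
  tiles : ∀ q : Fin d → ℤ, ∃! B : Block d, B ∈ 𝓑 ∧ (q ∈ B.alphaCells ∨ q ∈ B.betaCells)

open Classical in
/-- The domino block potential: `α` on the `α`-cubes of all blocks, `β` elsewhere. -/
def potential {d : ℕ} (n : ℕ) (𝓑 : Set (Block d)) (α β : ℝ) (x : Fin d → ℝ) : ℝ :=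
  if ∃ B ∈ 𝓑, x ∈ B.alphaCube n 0 then α else β

/-- The blocks of size larger than `ℓ`. -/
def large {d : ℕ} (ℓ : ℕ) (𝓑 : Set (Block d)) : Set (Block d) := {B | B ∈ 𝓑 ∧ ℓ < B.size}

/-- The set `D_{α,>ℓ}` (extended periodically): the union of the `α`-cubes of all large blocks. -/
def largeAlpha {d : ℕ} (n ℓ : ℕ) (𝓑 : Set (Block d)) : Set (Fin d → ℝ) :=
  {x | ∃ B ∈ large ℓ 𝓑, x ∈ B.alphaCube n 0}

/-! ### The mesh on the large `α`-cubes -/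

/-- Mesh size on the `α`-cube of `B` if each of its edges is divided into `N B` equal parts. -/
def meshSize {d : ℕ} (n : ℕ) (N : Block d → ℕ) (B : Block d) : ℝ := eps n * B.size / N B

/-- The node with index `i ∈ {0, …, N B}ᵈ` of the mesh on the `α`-cube of `B`. -/
def node {d : ℕ} (n : ℕ) (N : Block d → ℕ) (B : Block d) (i : Fin d → Fin (N B + 1)) :
    Fin d → ℝ :=
  fun k => eps n * B.corner k + meshSize n N B * (i k : ℕ)

/-- `N` describes a (periodic) uniform Cartesian mesh on `D_{α,>ℓ}`: the `α`-cube of a large block `B`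
is divided into `(N B)ᵈ` cubes of side length `h_B` with `ε ≤ h_B ≤ c ε ℓ`, and if the closed
`α`-cubes of two large blocks touch, their meshes are parts of one and the same uniform grid. -/
structure IsMesh {d : ℕ} (n ℓ : ℕ) (𝓑 : Set (Block d)) (c : ℝ) (N : Block d → ℕ) : Prop where
  pos : ∀ B ∈ large ℓ 𝓑, 0 < N B
  le_meshSize : ∀ B ∈ large ℓ 𝓑, eps n ≤ meshSize n N B
  meshSize_le : ∀ B ∈ large ℓ 𝓑, meshSize n N B ≤ c * (eps n * ℓ)
  shift : ∀ B ∈ large ℓ 𝓑, ∀ m : Fin d → ℤ, N (B.shift n m) = N B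
  conform : ∀ B ∈ large ℓ 𝓑, ∀ B' ∈ large ℓ 𝓑, (B.alphaCube n 0 ∩ B'.alphaCube n 0).Nonempty →
    meshSize n N B = meshSize n N B' ∧
      ∀ k, ∃ z : ℤ, eps n * B.corner k - eps n * B'.corner k = z * meshSize n N B

open Classical in
/-- The mesh size at a point of `D_{α,>ℓ}` (on a conforming mesh it does not depend on the choice of
the large `α`-cube that contains the point). -/
def sizeAt {d : ℕ} (n ℓ : ℕ) (𝓑 : Set (Block d)) (N : Block d → ℕ) (x : Fin d → ℝ) : ℝ :=
  if hx : ∃ B ∈ large ℓ 𝓑, x ∈ B.alphaCube n 0 then meshSize n N hx.choose else 0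

/-! ### The `Q₁` space on the extended mesh -/

/-- The one-dimensional hat function. -/
def hat (t : ℝ) : ℝ := max 0 (1 - |t|)

/-- The `Q₁` function on the mesh of the `α`-cube of `B` with the nodal values `c`. -/
def q1Block {d : ℕ} (n : ℕ) (N : Block d → ℕ) (c : (Fin d → ℝ) → ℝ) (B : Block d)
    (x : Fin d → ℝ) : ℝ :=
  ∑ i : Fin d → Fin (N B + 1),
    c (node n N B i) * ∏ k, hat ((x k - node n N B i k) / meshSize n N B)

open Classical in
/-- The continuous `Q₁` finite element function on `D_{α,>ℓ}` with the nodal values `c`,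
put equal to `0` outside `D_{α,>ℓ}`. -/
def q1Large {d : ℕ} (n ℓ : ℕ) (𝓑 : Set (Block d)) (N : Block d → ℕ) (c : (Fin d → ℝ) → ℝ)
    (x : Fin d → ℝ) : ℝ :=
  if hx : ∃ B ∈ large ℓ 𝓑, x ∈ B.alphaCube n 0 then q1Block n N c hx.choose x else 0

/-- The distance of the coordinate `y` to the next point below it of the grid `a + hℤ`. -/
def gridRem (a h y : ℝ) : ℝ := (y - a) - h * ⌊(y - a) / h⌋

/-- Subdivide `[0,h]` at `δ` and `h - δ`: left end point of the part that contains `r`. -/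
def subLo (δ h r : ℝ) : ℝ := if r < δ then 0 else if r < h - δ then δ else h - δ

/-- Subdivide `[0,h]` at `δ` and `h - δ`: right end point of the part that contains `r`. -/
def subHi (δ h r : ℝ) : ℝ := if r < δ then δ else if r < h - δ then h - δ else h

/-- Multilinear interpolation of `f` at `x`, on the tensor product grid that consists of the mesh
lines of the `α`-cube of `B` (continued to `ℝᵈ`) and of the lines at distance `ε/2` from them. -/
def fineInterp {d : ℕ} (n : ℕ) (N : Block d → ℕ) (B : Block d) (f : (Fin d → ℝ) → ℝ)
    (x : Fin d → ℝ) : ℝ :=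
  let h := meshSize n N B
  let δ := eps n / 2
  let r : Fin d → ℝ := fun k => gridRem (eps n * B.corner k) h (x k)
  let lo : Fin d → ℝ := fun k => subLo δ h (r k)
  let hi : Fin d → ℝ := fun k => subHi δ h (r k)
  ∑ s : Fin d → Bool,
    (∏ k, if s k then (r k - lo k) / (hi k - lo k) else (hi k - r k) / (hi k - lo k)) *
      f (fun k => x k - r k + if s k then hi k else lo k)

open Classical in
/-- The `Q₁` function on the extended mesh with nodal values `c` at the nodes in `D_{α,>ℓ}` and zero
values at all other nodes. The mesh on `D_{α,>ℓ}` is extended by one layer of elements of width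
`ε/2`. In this layer the function is the multilinear interpolant, on the grid with the additional
lines at distance `ε/2`, of the values on `D_{α,>ℓ}` and of zero values at the points outside.
(For an isolated cube these are the usual tensor products of hat functions, with the outermost hats
cut down to width `ε/2`; at re-entrant corners of `D_{α,>ℓ}` the points of the refined grid that lie
on `D_{α,>ℓ}` are hanging nodes, which take the interpolated value.) -/
def extend {d : ℕ} (n ℓ : ℕ) (𝓑 : Set (Block d)) (N : Block d → ℕ) (c : (Fin d → ℝ) → ℝ)
    (x : Fin d → ℝ) : ℝ :=
  if x ∈ largeAlpha n ℓ 𝓑 then q1Large n ℓ 𝓑 N c x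
  else if hx : ∃ B ∈ large ℓ 𝓑, x ∈ B.alphaCube n (eps n / 2) then
    fineInterp n N hx.choose (q1Large n ℓ 𝓑 N c) x
  else 0

/-- The finite element space `W_ℓ` on the extended mesh with homogeneous Dirichlet conditions. -/
def feSpace {d : ℕ} (n ℓ : ℕ) (𝓑 : Set (Block d)) (N : Block d → ℕ) :
    Set ((Fin d → ℝ) → ℝ) :=
  {w | ∃ c : (Fin d → ℝ) → ℝ, (∀ (m : Fin d → ℤ) (z : Fin d → ℝ), c (z + intVec m) = c z) ∧
    w = extend n ℓ 𝓑 N c}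

/-! ### The Scott-Zhang operator -/

/-- For each node `z`, the choice of a mesh cell with vertex `z`, namely the cube spanned by `z` and
the vectors `± h e_k` with the signs `sgn z`, and of the set of integration: the whole cell
(`face z = none`), or its face through `z` orthogonal to `e_k` (`face z = some k`). -/
structure SZChoice (d : ℕ) where
  sgn : (Fin d → ℝ) → Fin d → Bool
  face : (Fin d → ℝ) → Option (Fin d)

/-- The point with local coordinates `t ∈ [0,1]ᵈ` of the cube spanned by `z` and `± h e_k`. -/
def cellPoint {d : ℕ} (h : ℝ) (s : Fin d → Bool) (z t : Fin d → ℝ) : Fin d → ℝ :=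
  fun k => z k + h * (if s k then 1 else -1) * t k

/-- The choice is admissible: periodic, and the cells chosen are contained in `D_{α,>ℓ}`. -/
structure SZChoice.IsAdmissible {d : ℕ} (n ℓ : ℕ) (𝓑 : Set (Block d)) (N : Block d → ℕ)
    (S : SZChoice d) : Prop where
  periodic : ∀ (m : Fin d → ℤ) (z : Fin d → ℝ),
    S.sgn (z + intVec m) = S.sgn z ∧ S.face (z + intVec m) = S.face z
  cell_subset : ∀ B ∈ large ℓ 𝓑, ∀ i : Fin d → Fin (N B + 1), ∀ t ∈ Set.Icc (0 : Fin d → ℝ) 1,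
    cellPoint (meshSize n N B) (S.sgn (node n N B i)) (node n N B i) t ∈ largeAlpha n ℓ 𝓑

/-- The Scott-Zhang functional `u ↦ ∫_σ ψ u`, where `ψ` is the `Q₁` function on `σ` that is
`L²(σ)`-dual to the nodal basis function of the vertex `z`. In local coordinates on the reference
cube it is the product of the factors `4 - 6 t_k`. If `σ` is the face `t_k = 0`, the values of
`u ∈ H¹` on `σ` are understood as traces, expressed by the trace identity
`u|_{t_k = 0} = ∫₀¹ (u - (1 - t_k) ∂u/∂t_k) dt_k`. -/
def szFunctional {d : ℕ} (u : (Fin d → ℝ) → ℝ) (g : Fin d → (Fin d → ℝ) → ℝ) (h : ℝ)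
    (s : Fin d → Bool) (z : Fin d → ℝ) : Option (Fin d) → ℝ
  | none => ∫ t in Set.Icc (0 : Fin d → ℝ) 1, (∏ k, (4 - 6 * t k)) * u (cellPoint h s z t)
  | some k => ∫ t in Set.Icc (0 : Fin d → ℝ) 1, (∏ j ∈ Finset.univ.erase k, (4 - 6 * t j)) *
      (u (cellPoint h s z t) -
        (1 - t k) * (h * (if s k then 1 else -1) * g k (cellPoint h s z t)))

/-- The nodal values of the Scott-Zhang interpolant of `u ∈ H¹_per(D)` with weak gradient `g`. -/
def szNodal {d : ℕ} (n ℓ : ℕ) (𝓑 : Set (Block d)) (N : Block d → ℕ) (S : SZChoice d)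
    (u : (Fin d → ℝ) → ℝ) (g : Fin d → (Fin d → ℝ) → ℝ) (z : Fin d → ℝ) : ℝ :=
  szFunctional u g (sizeAt n ℓ 𝓑 N z) (S.sgn z) z (S.face z)

/-- The Scott-Zhang interpolant of `u` on `D_{α,>ℓ}`. -/
def scottZhang {d : ℕ} (n ℓ : ℕ) (𝓑 : Set (Block d)) (N : Block d → ℕ) (S : SZChoice d)
    (u : (Fin d → ℝ) → ℝ) (g : Fin d → (Fin d → ℝ) → ℝ) : (Fin d → ℝ) → ℝ :=
  q1Large n ℓ 𝓑 N (szNodal n ℓ 𝓑 N S u g)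

/-- The local projection `Π_ℓ` onto `W_ℓ`: the element of `W_ℓ` that coincides with the Scott-Zhang
interpolant on `D_{α,>ℓ}`. -/
def localProjection {d : ℕ} (n ℓ : ℕ) (𝓑 : Set (Block d)) (N : Block d → ℕ) (S : SZChoice d)
    (u : (Fin d → ℝ) → ℝ) (g : Fin d → (Fin d → ℝ) → ℝ) : (Fin d → ℝ) → ℝ :=
  extend n ℓ 𝓑 N (szNodal n ℓ 𝓑 N S u g)

theorem localProjection_eqOn {d : ℕ} (n ℓ : ℕ) (𝓑 : Set (Block d)) (N : Block d → ℕ)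
    (S : SZChoice d) (u : (Fin d → ℝ) → ℝ) (g : Fin d → (Fin d → ℝ) → ℝ) :
    Set.EqOn (localProjection n ℓ 𝓑 N S u g) (scottZhang n ℓ 𝓑 N S u g)
      (largeAlpha n ℓ 𝓑) := by
  intro x hx
  simp only [localProjection, scottZhang, extend, if_pos hx]

theorem mem_alphaCube_shift {d : ℕ} {n : ℕ} (hn : 0 < n) {r : ℝ} {B : Block d} {x : Fin d → ℝ}
    (m : Fin d → ℤ) (hx : x ∈ B.alphaCube n r) : x + intVec m ∈ (B.shift n m).alphaCube n r := by
  intro k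
  have h := hx k
  have hn' : (n : ℝ) ≠ 0 := by positivity
  have e : eps n * n = 1 := by simp [eps, hn']
  have e' : eps n * (n * (m k : ℝ)) = m k := by rw [← mul_assoc, e, one_mul]
  simp only [Block.shift, intVec, Pi.add_apply, Int.cast_add, Int.cast_mul, Int.cast_natCast,
    mul_add, e'] at h ⊢
  constructor <;> linarith [h.1, h.2]

theorem sizeAt_eq {d : ℕ} {n ℓ : ℕ} {𝓑 : Set (Block d)} {c : ℝ} {N : Block d → ℕ}
    (hN : IsMesh n ℓ 𝓑 c N) {B : Block d} (hB : B ∈ large ℓ 𝓑) {x : Fin d → ℝ}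
    (hx : x ∈ B.alphaCube n 0) : sizeAt n ℓ 𝓑 N x = meshSize n N B := by
  have h : ∃ B ∈ large ℓ 𝓑, x ∈ B.alphaCube n 0 := ⟨B, hB, hx⟩
  rw [sizeAt, dif_pos h]
  exact (hN.conform _ h.choose_spec.1 B hB ⟨x, h.choose_spec.2, hx⟩).1

/-- The local projection takes values in `W_ℓ`. -/
theorem localProjection_mem {d : ℕ} {n L ℓ : ℕ} (hn : 0 < n) {𝓑 : Set (Block d)} {c : ℝ}
    {N : Block d → ℕ} {S : SZChoice d} (h𝓑 : IsTiling n L 𝓑) (hN : IsMesh n ℓ 𝓑 c N)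
    (hS : S.IsAdmissible n ℓ 𝓑 N) {u : (Fin d → ℝ) → ℝ} {g : Fin d → (Fin d → ℝ) → ℝ}
    (hu : IsH1Per u g) : localProjection n ℓ 𝓑 N S u g ∈ feSpace n ℓ 𝓑 N := by
  refine ⟨_, fun m z => ?_, rfl⟩
  have hlarge : ∀ B ∈ large ℓ 𝓑, ∀ m : Fin d → ℤ, B.shift n m ∈ large ℓ 𝓑 :=
    fun B hB m => ⟨h𝓑.shift_mem B hB.1 m, hB.2⟩
  have hsize : sizeAt n ℓ 𝓑 N (z + intVec m) = sizeAt n ℓ 𝓑 N z := by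
    by_cases hz : ∃ B ∈ large ℓ 𝓑, z ∈ B.alphaCube n 0
    · obtain ⟨B, hB, hzB⟩ := hz
      rw [sizeAt_eq hN hB hzB, sizeAt_eq hN (hlarge B hB m) (mem_alphaCube_shift hn m hzB),
        meshSize, meshSize, hN.shift B hB m]
      rfl
    · have hz' : ¬ ∃ B ∈ large ℓ 𝓑, z + intVec m ∈ B.alphaCube n 0 := by
        rintro ⟨B, hB, hzB⟩
        refine hz ⟨_, hlarge B hB (-m), ?_⟩
        have h := mem_alphaCube_shift hn (-m) hzB
        have e : z + intVec m + intVec (-m) = z := by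
          funext k
          simp [intVec]
        rwa [e] at h
      rw [sizeAt, sizeAt, dif_neg hz, dif_neg hz']
  have hcell : ∀ h s t, cellPoint h s (z + intVec m) t = cellPoint h s z t + intVec m := by
    intro h s t
    funext k
    simp only [cellPoint, Pi.add_apply]
    ring
  rw [szNodal, szNodal, hsize, (hS.periodic m z).1, (hS.periodic m z).2]
  cases S.face z <;> simp only [szFunctional, hcell, hu.periodic, hu.periodic_grad]

end Domino

end

/-! The square of `u - Πu` is bounded pointwise by two terms, one living off the large `α`-cubes and
one being a sum of local interpolation errors. Each is then integrated against the energy.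

Every value of the extended finite element function is a convex combination of Scott–Zhang nodal
values and, in the layer or outside, of zeros. By convexity of the square, `|u(x) - Πu(x)|²` is at
most the largest of `|u(x) - c_z|²` over nodes `z` within `2h` of `x`, plus `|u(x)|²` if `x` is not
in `D_{α,>ℓ}` (`esq_sub_extend_le`). Zero boundary values therefore cost only `|u|²` off the large
cubes.

For the nodal terms, the Scott–Zhang functional reproduces constants and is bounded, so `|u(x) -
c_z|²` is at most a constant times the mean of `|u(x) - u(y)|² + h²|∇u(y)|²` over a cube of size
comparable to `h` around `x` (`esq_sub_szFunctional_le`, `localError`). Integrating in `x` for fixed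
`w = y - x` needs only the estimate of `u(x + w) - u(x)` by `|w|` times the gradient
(`lintegral_esq_translate_sub_le`), which comes from an a.e. fundamental theorem of calculus for
weak derivatives (`ae_translate_sub`). This replaces a Poincaré inequality on patches. Since `u`
lives on all of `ℝᵈ`, full cubes may be used irrespective of the shape of `D_{α,>ℓ}`. Because `h ≤ c
ε ℓ` while large blocks have more than `ℓ` cells per edge, the enlarged cubes overlap boundedly
often (`encard_large_le`), and the sum over blocks is `O((εℓ)²)` times the gradient energy.

Off the large `α`-cubes a point lies in a `β`-cube or in an `α`-cube of size `j ≤ ℓ`. On `β`-cubes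
`V = β ≥ c_β ε⁻²`, so `|u|²` is at most `ε²/c_β` times the energy density. A small `α`-cube is
translated onto its `β`-cube over the distance `εj ≤ εℓ`, at the cost of the gradient inside the
block (`lintegral_alphaSet_le`). Blocks do not overlap, so these bounds add up. -/

noncomputable section

namespace Domino

open scoped ENNReal

variable {d : ℕ}

/-! ### Difference quotients of functions with a weak gradient -/

section Translation

/-- For `s ∈ (0,1]` the supports of the shifted `φ` stay in the compact set swept out by `K` along
`w`, where `G` is integrable. This supplies the integrability for exchanging the integrals in `s`
and `x` below. -/
theorem integrable_mul_comp_sub_smul {G φ : (Fin d → ℝ) → ℝ} (hG : LocallyIntegrable G volume)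
    (hGm : Measurable G) (hφm : Measurable φ) {C : ℝ} (hC : ∀ x, |φ x| ≤ C)
    {K : Set (Fin d → ℝ)} (hK : IsCompact K) (hφ : ∀ x ∉ K, φ x = 0) (w : Fin d → ℝ) :
    Integrable (fun p : ℝ × (Fin d → ℝ) => φ (p.2 - p.1 • w) * G p.2)
      ((volume.restrict (Set.Ioc (0 : ℝ) 1)).prod volume) := by
  set K' : Set (Fin d → ℝ) := (fun p : ℝ × (Fin d → ℝ) => p.2 + p.1 • w) '' (Set.Icc 0 1 ×ˢ K)
  have hK' : IsCompact K' := (isCompact_Icc.prod hK).image (by fun_prop)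
  have hint : Integrable (K'.indicator fun x => C * ‖G x‖) volume :=
    (integrable_indicator_iff hK'.measurableSet).2 ((hG.integrableOn_isCompact hK').norm.const_mul C)
  have hprod : Integrable (fun p : ℝ × (Fin d → ℝ) => K'.indicator (fun x => C * ‖G x‖) p.2)
      ((volume.restrict (Set.Ioc (0 : ℝ) 1)).prod volume) :=
    hint.comp_snd (volume.restrict (Set.Ioc (0 : ℝ) 1))
  refine hprod.mono' (by fun_prop) ?_
  have hs : ∀ᵐ p : ℝ × (Fin d → ℝ) ∂((volume.restrict (Set.Ioc (0 : ℝ) 1)).prod volume),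
      p.1 ∈ Set.Ioc (0 : ℝ) 1 :=
    Measure.quasiMeasurePreserving_fst.ae (ae_restrict_mem measurableSet_Ioc)
  filter_upwards [hs] with p hp
  by_cases hx : p.2 - p.1 • w ∈ K
  · have : p.2 ∈ K' := ⟨(p.1, p.2 - p.1 • w), ⟨⟨hp.1.le, hp.2⟩, hx⟩, by simp⟩
    rw [Set.indicator_of_mem this, norm_mul]
    exact mul_le_mul_of_nonneg_right (hC _) (norm_nonneg _)
  · rw [hφ _ hx, zero_mul, norm_zero]
    refine Set.indicator_nonneg (fun x _ => mul_nonneg ?_ (norm_nonneg _)) _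
    exact (abs_nonneg _).trans (hC 0)

/-- This shear moves the shift from `φ` to `G`, so that integrability of one product gives that of
the other. -/
theorem measurePreserving_add_smul (w : Fin d → ℝ) :
    MeasurePreserving (fun p : ℝ × (Fin d → ℝ) => (p.1, p.2 + p.1 • w))
      ((volume.restrict (Set.Ioc (0 : ℝ) 1)).prod volume)
      ((volume.restrict (Set.Ioc (0 : ℝ) 1)).prod volume) := by
  refine (MeasurePreserving.id _).skew_product (g := fun s x => x + s • w) (by fun_prop) ?_
  exact Filter.Eventually.of_forall fun s => map_add_right_eq_self volume (s • w)

theorem integrable_mul_comp_add_smul {G φ : (Fin d → ℝ) → ℝ} (hG : LocallyIntegrable G volume)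
    (hGm : Measurable G) (hφm : Measurable φ) {C : ℝ} (hC : ∀ x, |φ x| ≤ C)
    {K : Set (Fin d → ℝ)} (hK : IsCompact K) (hφ : ∀ x ∉ K, φ x = 0) (w : Fin d → ℝ) :
    Integrable (fun p : ℝ × (Fin d → ℝ) => φ p.2 * G (p.2 + p.1 • w))
      ((volume.restrict (Set.Ioc (0 : ℝ) 1)).prod volume) := by
  have h := (measurePreserving_add_smul w).integrable_comp_of_integrable
    (integrable_mul_comp_sub_smul hG hGm hφm hC hK hφ w)
  simpa [Function.comp_def] using h

/-- Both sides have equal integrals against every test function: the translation is shifted onto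
`φ`, the classical fundamental theorem is applied to `φ` along the segment, the weak derivative
moves the gradient back to `u`, and Fubini exchanges the integrals. -/
theorem ae_translate_sub {u : (Fin d → ℝ) → ℝ} {g : Fin d → (Fin d → ℝ) → ℝ}
    (hu : LocallyIntegrable u volume) (hum : Measurable u)
    (hg : ∀ k, LocallyIntegrable (g k) volume) (hgm : ∀ k, Measurable (g k))
    (hweak : ∀ (k : Fin d) (φ : (Fin d → ℝ) → ℝ), ContDiff ℝ ∞ φ → HasCompactSupport φ →
      ∫ x, u x * fderiv ℝ φ x (Pi.single k 1) = - ∫ x, g k x * φ x) (w : Fin d → ℝ) :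
    ∀ᵐ x, u (x + w) - u x = ∫ s in Set.Ioc (0 : ℝ) 1, ∑ k, w k * g k (x + s • w) := by
  set G : (Fin d → ℝ) → ℝ := fun x => ∑ k, w k * g k x with hGdef
  have hGm : Measurable G := by fun_prop
  have hG : LocallyIntegrable G volume := by
    have : G = ∑ k, (w k) • g k := by ext x; simp [G]
    rw [this]
    exact Finset.sum_induction _ (fun f => LocallyIntegrable f volume) (fun a b ha hb => ha.add hb)
      (locallyIntegrable_zero) (fun k _ => (hg k).smul (w k))
  have hweak' : ∀ φ : (Fin d → ℝ) → ℝ, ContDiff ℝ ∞ φ → HasCompactSupport φ →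
      ∫ x, u x * fderiv ℝ φ x w = - ∫ x, G x * φ x := by
    intro φ hφ hφc
    have e1 : ∀ x, u x * fderiv ℝ φ x w
        = ∑ k, w k * (u x * fderiv ℝ φ x (Pi.single k 1)) := by
      intro x
      have : w = ∑ k, w k • (Pi.single k 1 : Fin d → ℝ) := by
        ext j; simp [Finset.sum_apply, Pi.single_apply]
      conv_lhs => rw [this]
      simp only [map_sum, map_smul, smul_eq_mul, Finset.mul_sum]
      exact Finset.sum_congr rfl fun k _ => by ring
    have e2 : ∀ x, G x * φ x = ∑ k, w k * (g k x * φ x) := by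
      intro x
      simp only [G, Finset.sum_mul]
      exact Finset.sum_congr rfl fun k _ => by ring
    simp_rw [e1, e2]
    rw [integral_finsetSum, integral_finsetSum, ← Finset.sum_neg_distrib]
    · refine Finset.sum_congr rfl fun k _ => ?_
      rw [integral_const_mul, integral_const_mul, hweak k φ hφ hφc]
      ring
    · intro k _
      refine Integrable.const_mul ?_ _
      have := (hg k).integrable_smul_left_of_hasCompactSupport hφ.continuous hφc
      simpa [mul_comm] using this
    · intro k _
      refine Integrable.const_mul ?_ _
      have hc : Continuous fun x => fderiv ℝ φ x (Pi.single k 1) :=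
        (hφ.continuous_fderiv (by simp)).clm_apply continuous_const
      have hs : HasCompactSupport fun x => fderiv ℝ φ x (Pi.single k 1) :=
        (hφc.fderiv_apply (𝕜 := ℝ) _)
      have := hu.integrable_smul_left_of_hasCompactSupport hc hs
      simpa [mul_comm] using this
  have hut : LocallyIntegrable (fun x => u (x + w)) volume := by
    rw [locallyIntegrable_iff]
    intro K hK
    have hm := (measurePreserving_add_right (volume : Measure (Fin d → ℝ)) w)
    have h2 : IsCompact ((fun x => x + w) '' K) := hK.image (by fun_prop)
    have h3 := (hm.integrableOn_comp_preimage (measurableEmbedding_addRight w)).2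
      (hu.integrableOn_isCompact h2)
    refine h3.mono_set ?_
    exact Set.subset_preimage_image _ _
  have hH : LocallyIntegrable (fun x => ∫ s in Set.Ioc (0 : ℝ) 1, G (x + s • w)) volume := by
    rw [locallyIntegrable_iff]
    intro K hK
    -- The indicator of `K` serves as `φ`, for which only boundedness, measurability and compact
    -- support are needed.
    have h1 := integrable_mul_comp_add_smul hG hGm (φ := K.indicator 1)
      (measurable_one.indicator hK.measurableSet) (C := 1)
      (fun x => by by_cases hx : x ∈ K <;> simp [hx]) hK
      (fun x hx => Set.indicator_of_notMem hx _) w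
    have h2 := h1.integral_prod_right
    rw [← integrable_indicator_iff hK.measurableSet]
    refine h2.congr (Filter.Eventually.of_forall fun x => ?_)
    by_cases hx : x ∈ K <;> simp [hx]
  refine ae_eq_of_integral_contDiff_smul_eq (hut.sub hu) hH fun φ hφ hφc => ?_
  have hφ' : Continuous fun x => fderiv ℝ φ x w :=
    (hφ.continuous_fderiv (by simp)).clm_apply continuous_const
  have hφ's : HasCompactSupport fun x => fderiv ℝ φ x w := hφc.fderiv_apply (𝕜 := ℝ) _
  obtain ⟨C, hC⟩ := hφ.continuous.bounded_above_of_compact_support hφc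
  obtain ⟨C', hC'⟩ := hφ'.bounded_above_of_compact_support hφ's
  have i1 : Integrable (fun x => φ x * u x) volume := by
    simpa using hu.integrable_smul_left_of_hasCompactSupport hφ.continuous hφc
  have i2 : Integrable (fun x => φ x * u (x + w)) volume := by
    simpa using hut.integrable_smul_left_of_hasCompactSupport hφ.continuous hφc
  -- The variation of the test function along the segment, where differentiability is classical.
  have ftc : ∀ x, φ (x - w) - φ x
      = - ∫ s in Set.Ioc (0 : ℝ) 1, fderiv ℝ φ (x - s • w) w := by
    intro x
    have hd : ∀ s ∈ Set.uIcc (0 : ℝ) 1,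
        HasDerivAt (fun s : ℝ => φ (x - s • w)) (-fderiv ℝ φ (x - s • w) w) s := by
      intro s _
      have h1 : HasDerivAt (fun s : ℝ => x - s • w) (-w) s := by
        simpa using ((hasDerivAt_id s).smul_const w).const_sub x
      have h2 := ((hφ.differentiable (by simp)) (x - s • w)).hasFDerivAt.comp_hasDerivAt s h1
      simpa [Function.comp_def] using h2
    have h := intervalIntegral.integral_eq_sub_of_hasDerivAt hd
      ((Continuous.neg (hφ'.comp (by fun_prop : Continuous fun s : ℝ => x - s • w))).intervalIntegrable 0 1)
    rw [intervalIntegral.integral_of_le zero_le_one, integral_neg] at h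
    simpa using h.symm
  have tr : ∫ x, φ x * u (x + w) = ∫ x, φ (x - w) * u x := by
    rw [← integral_add_right_eq_self (μ := volume) (fun x => φ (x - w) * u x) w]
    simp
  have i3 : Integrable (fun x => φ (x - w) * u x) volume := by
    have := i2.comp_sub_right w
    simpa using this
  calc ∫ x, φ x • ((fun x => u (x + w)) - u) x
      = ∫ x, (φ (x - w) - φ x) * u x := by
        simp only [Pi.sub_apply, smul_eq_mul, mul_sub, sub_mul]
        rw [integral_sub i2 i1, integral_sub i3 i1, tr]
    _ = - ∫ x, ∫ s in Set.Ioc (0 : ℝ) 1, fderiv ℝ φ (x - s • w) w * u x := by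
        rw [← integral_neg]
        congr 1
        ext x
        rw [ftc, neg_mul, integral_mul_const]
    _ = - ∫ s in Set.Ioc (0 : ℝ) 1, ∫ x, fderiv ℝ φ (x - s • w) w * u x := by
        rw [integral_integral_swap]
        exact (integrable_mul_comp_sub_smul hu hum hφ'.measurable hC' hφ's
          (fun x hx => image_eq_zero_of_notMem_tsupport (f := fun x => fderiv ℝ φ x w) hx) w).swap
    _ = ∫ s in Set.Ioc (0 : ℝ) 1, ∫ x, φ x * G (x + s • w) := by
        rw [← integral_neg]
        congr 1
        ext s
        have hc : HasCompactSupport fun x => φ (x - s • w) := by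
          have := hφc.comp_homeomorph (Homeomorph.subRight (s • w))
          exact this
        have h := hweak' (fun x => φ (x - s • w)) (hφ.comp (contDiff_id.sub contDiff_const)) hc
        have e : ∀ x, fderiv ℝ (fun x => φ (x - s • w)) x = fderiv ℝ φ (x - s • w) :=
          fun x => fderiv_comp_sub (s • w)
        simp_rw [e] at h
        simp_rw [mul_comm _ (u _), h, neg_neg]
        rw [← integral_add_right_eq_self (μ := volume) (fun x => G x * φ (x - s • w)) (s • w)]
        simp [mul_comm]
    _ = ∫ x, ∫ s in Set.Ioc (0 : ℝ) 1, φ x * G (x + s • w) := by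
        rw [integral_integral_swap]
        exact integrable_mul_comp_add_smul hG hGm hφ.continuous.measurable hC hφc
          (fun x hx => image_eq_zero_of_notMem_tsupport hx) w
    _ = _ := by
        congr 1
        ext x
        rw [integral_const_mul, smul_eq_mul]

end Translation

/-! ### Squares as extended nonnegative reals, and Jensen's inequality -/

section Energy

/-- The square of a real number as an extended nonnegative real. -/
def esq (a : ℝ) : ℝ≥0∞ := ENNReal.ofReal (a ^ 2)

/-- The squared Euclidean length of the vector `(g k x)ₖ`. -/
def gsq (g : Fin d → (Fin d → ℝ) → ℝ) (x : Fin d → ℝ) : ℝ≥0∞ := ENNReal.ofReal (∑ k, g k x ^ 2)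

theorem esq_eq_enorm (a : ℝ) : esq a = ‖a‖ₑ ^ 2 := by
  rw [esq, ← sq_abs, ENNReal.ofReal_pow (abs_nonneg a), ← Real.enorm_eq_ofReal_abs]

theorem esq_neg (a : ℝ) : esq (-a) = esq a := by simp [esq]

theorem esq_mul (a b : ℝ) : esq (a * b) = esq a * esq b := by
  simp only [esq_eq_enorm, enorm_mul, mul_pow]

theorem esq_add_le (a b : ℝ) : esq (a + b) ≤ 2 * esq a + 2 * esq b := by
  have h : (a + b) ^ 2 ≤ 2 * a ^ 2 + 2 * b ^ 2 := by nlinarith [sq_nonneg (a - b)]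
  rw [esq, esq, esq]
  refine (ENNReal.ofReal_le_ofReal h).trans ?_
  rw [ENNReal.ofReal_add (by positivity) (by positivity), ENNReal.ofReal_mul (by norm_num),
    ENNReal.ofReal_mul (by norm_num)]
  simp

theorem esq_mono {a b : ℝ} (h : |a| ≤ |b|) : esq a ≤ esq b :=
  ENNReal.ofReal_le_ofReal (sq_le_sq.2 h)

@[fun_prop]
theorem measurable_esq : Measurable esq := by unfold esq; fun_prop

theorem measurable_gsq {g : Fin d → (Fin d → ℝ) → ℝ} (hg : ∀ k, Measurable (g k)) :
    Measurable (gsq g) := by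
  unfold gsq; fun_prop

theorem esq_le_gsq (g : Fin d → (Fin d → ℝ) → ℝ) (k : Fin d) (x : Fin d → ℝ) :
    esq (g k x) ≤ gsq g x :=
  ENNReal.ofReal_le_ofReal
    (Finset.single_le_sum (f := fun k => g k x ^ 2) (fun _ _ => sq_nonneg _) (Finset.mem_univ k))

theorem sq_lintegral_le {α : Type*} [MeasurableSpace α] {μ : Measure α} [IsProbabilityMeasure μ]
    {f : α → ℝ≥0∞} (hf : AEMeasurable f μ) : (∫⁻ x, f x ∂μ) ^ 2 ≤ ∫⁻ x, f x ^ 2 ∂μ := by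
  have h := ENNReal.lintegral_mul_le_Lp_mul_Lq μ Real.HolderConjugate.two_two hf
    (aemeasurable_const (b := (1 : ℝ≥0∞)))
  simp only [Pi.mul_apply, mul_one, ENNReal.one_rpow, lintegral_const, measure_univ] at h
  calc (∫⁻ x, f x ∂μ) ^ 2 ≤ ((∫⁻ x, f x ^ (2 : ℝ) ∂μ) ^ (1 / (2 : ℝ))) ^ 2 := by gcongr
    _ = ∫⁻ x, f x ^ 2 ∂μ := by
      rw [← ENNReal.rpow_natCast, ← ENNReal.rpow_mul]
      norm_num

theorem esq_integral_le {α : Type*} [MeasurableSpace α] {μ : Measure α} [IsProbabilityMeasure μ]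
    {f : α → ℝ} (hf : AEMeasurable f μ) : esq (∫ x, f x ∂μ) ≤ ∫⁻ x, esq (f x) ∂μ := by
  simp only [esq_eq_enorm]
  calc ‖∫ x, f x ∂μ‖ₑ ^ 2 ≤ (∫⁻ x, ‖f x‖ₑ ∂μ) ^ 2 := by
        gcongr
        exact enorm_integral_le_lintegral_enorm f
    _ ≤ _ := sq_lintegral_le hf.enorm

theorem setLIntegral_comp_add_le {f : (Fin d → ℝ) → ℝ≥0∞} {A T : Set (Fin d → ℝ)}
    (w : Fin d → ℝ) (h : ∀ x ∈ A, x + w ∈ T) :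
    ∫⁻ x in A, f (x + w) ≤ ∫⁻ x in T, f x := by
  rw [← (measurePreserving_add_right volume w).setLIntegral_comp_preimage_emb
    (measurableEmbedding_addRight w) f T]
  exact lintegral_mono_set h

instance : IsProbabilityMeasure (volume.restrict (Set.Ioc (0 : ℝ) 1)) :=
  ⟨by simp⟩

end Energy

/-! ### Periodic functions: local integrability and Borel representatives -/

section Periodic

theorem unitCube_ae_eq_pi_Ico :
    (unitCube d : Set (Fin d → ℝ)) =ᵐ[volume] Set.univ.pi fun _ => Set.Ico 0 1 := by
  have h1 : (unitCube d : Set (Fin d → ℝ)) =ᵐ[volume] Set.Icc (fun _ => (0 : ℝ)) fun _ => 1 :=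
    Measure.univ_pi_Ioo_ae_eq_Icc
  have h2 : (Set.univ.pi fun _ : Fin d => Set.Ico (0 : ℝ) 1) =ᵐ[volume]
      Set.Icc (fun _ => (0 : ℝ)) fun _ => 1 := Measure.univ_pi_Ico_ae_eq_Icc
  exact h1.trans h2.symm

/-- Every point has an integer translate in the half-open unit cube, which differs from `D` by a
null set, and there are only countably many translations. -/
theorem ae_of_periodic {p : (Fin d → ℝ) → Prop}
    (hp : ∀ (m : Fin d → ℤ) x, p (x + intVec m) ↔ p x)
    (h : ∀ᵐ x ∂volume.restrict (unitCube d), p x) : ∀ᵐ x, p x := by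
  set Q : Set (Fin d → ℝ) := Set.univ.pi fun _ => Set.Ico 0 1
  have hQ : (unitCube d : Set (Fin d → ℝ)) =ᵐ[volume] Q := unitCube_ae_eq_pi_Ico
  rw [Measure.restrict_congr_set hQ, ae_restrict_iff' (MeasurableSet.univ_pi fun _ => measurableSet_Ico)] at h
  have hall : ∀ m : Fin d → ℤ, ∀ᵐ x, x + intVec m ∈ Q → p (x + intVec m) := fun m =>
    (measurePreserving_add_right volume (intVec m)).quasiMeasurePreserving.ae h
  filter_upwards [ae_all_iff.2 hall] with x hx
  have := hx (fun k => -⌊x k⌋) ?_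
  · exact (hp _ _).1 this
  · intro k _
    simp only [intVec, Pi.add_apply, Int.cast_neg, Set.mem_Ico]
    constructor <;> linarith [Int.floor_le (x k), Int.lt_floor_add_one (x k)]

/-- The coordinates of points of the box have integer parts from `-R` to `R`, the value `R` being
attained on the upper faces. Hence `(2R+1)^d` translates of the half-open unit cube cover it, and
each carries the same integral. -/
theorem setLIntegral_box_le {f : (Fin d → ℝ) → ℝ≥0∞}
    (hf : ∀ (m : Fin d → ℤ) x, f (x + intVec m) = f x) (R : ℕ) :
    ∫⁻ x in Set.Icc (fun _ => -(R : ℝ)) (fun _ => (R : ℝ)), f x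
      ≤ (2 * R + 1) ^ d * ∫⁻ x in unitCube d, f x := by
  set Q : Set (Fin d → ℝ) := Set.univ.pi fun _ => Set.Ico 0 1
  have hQ : (unitCube d : Set (Fin d → ℝ)) =ᵐ[volume] Q := unitCube_ae_eq_pi_Ico
  set M : Finset (Fin d → ℤ) := Fintype.piFinset fun _ => Finset.Icc (-(R : ℤ)) R
  have hM : M.card = (2 * R + 1) ^ d := by
    simp only [M, Fintype.card_piFinset_const, Int.card_Icc]
    congr 1
    omega
  have hsub : Set.Icc (fun _ => -(R : ℝ)) (fun _ => (R : ℝ)) ⊆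
      ⋃ m : M, (fun x => x + intVec (-m.1)) ⁻¹' Q := by
    intro x hx
    have hm : (fun k => ⌊x k⌋) ∈ M := by
      simp only [M, Fintype.mem_piFinset, Finset.mem_Icc]
      intro k
      have h1 := hx.1 k
      have h2 := hx.2 k
      refine ⟨Int.le_floor.2 (by push_cast; exact h1), ?_⟩
      have : (⌊x k⌋ : ℝ) ≤ (R : ℝ) := (Int.floor_le (x k)).trans h2
      exact_mod_cast this
    refine Set.mem_iUnion.2 ⟨⟨_, hm⟩, ?_⟩
    intro k _
    simp only [intVec, Pi.add_apply, Pi.neg_apply, Int.cast_neg, Set.mem_Ico]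
    constructor <;> linarith [Int.floor_le (x k), Int.lt_floor_add_one (x k)]
  calc _ ≤ ∑' m : M, ∫⁻ x in (fun x => x + intVec (-m.1)) ⁻¹' Q, f x :=
        (lintegral_mono_set hsub).trans (lintegral_iUnion_le _ _)
    _ = ∑' _ : M, ∫⁻ x in Q, f x := by
        congr 1
        ext m
        rw [← (measurePreserving_add_right volume (intVec (-m.1))).setLIntegral_comp_preimage_emb
          (measurableEmbedding_addRight _) f Q]
        simp_rw [hf]
    _ = _ := by
        rw [ENNReal.tsum_const, Measure.restrict_congr_set hQ]
        congr 1
        simp [hM]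

theorem locallyIntegrable_of_periodic {f : (Fin d → ℝ) → ℝ} (hfm : Measurable f)
    (hf : ∀ (m : Fin d → ℤ) x, f (x + intVec m) = f x)
    (h : MemLp f 2 (volume.restrict (unitCube d))) : LocallyIntegrable f volume := by
  have hfin : IsFiniteMeasure (volume.restrict (unitCube d)) := by
    refine ⟨?_⟩
    rw [Measure.restrict_apply_univ, unitCube, Real.volume_pi_Ioo]
    simp
  have h1 : Integrable f (volume.restrict (unitCube d)) := h.integrable (by norm_num)
  rw [locallyIntegrable_iff]
  intro K hK
  obtain ⟨R, hR⟩ := hK.isBounded.subset_closedBall (0 : Fin d → ℝ)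
  obtain ⟨R', hR'⟩ := exists_nat_ge R
  have hsub : K ⊆ Set.Icc (fun _ => -(R' : ℝ)) (fun _ => (R' : ℝ)) := by
    intro x hx
    have h2 := hR hx
    rw [mem_closedBall_zero_iff] at h2
    have h3 : ∀ k, |x k| ≤ R' := fun k => (norm_le_pi_norm x k).trans (h2.trans hR')
    exact ⟨fun k => (abs_le.1 (h3 k)).1, fun k => (abs_le.1 (h3 k)).2⟩
  refine IntegrableOn.mono_set ⟨hfm.aestronglyMeasurable, ?_⟩ hsub
  have h4 := setLIntegral_box_le (f := fun x => ‖f x‖ₑ) (fun m x => by rw [hf]) R'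
  exact h4.trans_lt (ENNReal.mul_lt_top (by
    exact ENNReal.pow_lt_top (by simp [ENNReal.mul_lt_top])) h1.hasFiniteIntegral)

/-- A measurable representative on `D` is composed with the fractional part. The Tonelli arguments
below require genuinely measurable functions. -/
theorem exists_measurable_periodic_ae_eq {f : (Fin d → ℝ) → ℝ}
    (hf : ∀ (m : Fin d → ℤ) x, f (x + intVec m) = f x)
    (h : MemLp f 2 (volume.restrict (unitCube d))) :
    ∃ f' : (Fin d → ℝ) → ℝ, Measurable f' ∧ (∀ (m : Fin d → ℤ) x, f' (x + intVec m) = f' x) ∧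
      f =ᵐ[volume] f' := by
  refine ⟨fun x => h.1.mk f fun k => Int.fract (x k), ?_, ?_, ?_⟩
  · have := h.1.stronglyMeasurable_mk.measurable
    fun_prop
  · intro m x
    simp [intVec]
  · refine ae_of_periodic (fun m x => ?_) ?_
    · simp [intVec, hf]
    · filter_upwards [h.1.ae_eq_mk, ae_restrict_mem
        (MeasurableSet.univ_pi fun _ => measurableSet_Ioo)] with x hx hxD
      have : (fun k => Int.fract (x k)) = x := by
        ext k
        have := hxD k (Set.mem_univ k)
        exact Int.fract_eq_self.2 ⟨this.1.le, this.2⟩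
      rw [this, ← hx]

theorem IsH1Per.exists_measurable {u : (Fin d → ℝ) → ℝ} {g : Fin d → (Fin d → ℝ) → ℝ}
    (hu : IsH1Per u g) : ∃ (u' : (Fin d → ℝ) → ℝ) (g' : Fin d → (Fin d → ℝ) → ℝ),
      IsH1Per u' g' ∧ Measurable u' ∧ (∀ k, Measurable (g' k)) ∧ u =ᵐ[volume] u' ∧
        ∀ k, g k =ᵐ[volume] g' k := by
  obtain ⟨u', h1, h2, h3⟩ := exists_measurable_periodic_ae_eq hu.periodic hu.memLp
  choose g' i1 i2 i3 using fun k =>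
    exists_measurable_periodic_ae_eq (hu.periodic_grad k) (hu.memLp_grad k)
  refine ⟨u', g', ⟨h2, i2, hu.memLp.ae_eq (ae_restrict_of_ae h3),
    fun k => (hu.memLp_grad k).ae_eq (ae_restrict_of_ae (i3 k)), fun k φ hφ hφc => ?_⟩,
    h1, i1, h3, i3⟩
  have e1 : ∫ x, u' x * fderiv ℝ φ x (Pi.single k 1)
      = ∫ x, u x * fderiv ℝ φ x (Pi.single k 1) :=
    integral_congr_ae (h3.mono fun x hx => by simp only [hx])
  have e2 : ∫ x, g' k x * φ x = ∫ x, g k x * φ x :=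
    integral_congr_ae ((i3 k).mono fun x hx => by simp only [hx])
  rw [e1, e2, hu.weak_deriv k φ hφ hφc]

end Periodic

/-! ### The translation estimate -/

section Poincare

/-- Cauchy–Schwarz in `s` and in the sum over `k`, then Tonelli. For fixed `s` the remaining
integral over `A` is one over a translate of `A` inside `T`. Nothing but the segments from `A` has
to lie in `T`, so no extension or convexity argument is involved. -/
theorem lintegral_esq_translate_sub_le {u : (Fin d → ℝ) → ℝ} {g : Fin d → (Fin d → ℝ) → ℝ}
    (hu : IsH1Per u g) (hum : Measurable u) (hgm : ∀ k, Measurable (g k))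
    {A T : Set (Fin d → ℝ)} (w : Fin d → ℝ)
    (hT : ∀ x ∈ A, ∀ s ∈ Set.Ioc (0 : ℝ) 1, x + s • w ∈ T) :
    ∫⁻ x in A, esq (u (x + w) - u x) ≤ ENNReal.ofReal (∑ k, w k ^ 2) * ∫⁻ x in T, gsq g x := by
  have hid := ae_translate_sub (locallyIntegrable_of_periodic hum hu.periodic hu.memLp) hum
    (fun k => locallyIntegrable_of_periodic (hgm k) (hu.periodic_grad k) (hu.memLp_grad k)) hgm
    hu.weak_deriv w
  have hG := measurable_gsq hgm
  calc ∫⁻ x in A, esq (u (x + w) - u x)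
      ≤ ∫⁻ x in A, ∫⁻ s in Set.Ioc (0 : ℝ) 1,
          ENNReal.ofReal (∑ k, w k ^ 2) * gsq g (x + s • w) := by
        refine lintegral_mono_ae ((ae_restrict_of_ae hid).mono fun x hx => ?_)
        rw [hx]
        refine (esq_integral_le (by fun_prop)).trans (lintegral_mono fun s => ?_)
        simp only [esq, gsq]
        rw [← ENNReal.ofReal_mul (Finset.sum_nonneg fun _ _ => sq_nonneg _)]
        exact ENNReal.ofReal_le_ofReal (Finset.sum_mul_sq_le_sq_mul_sq _ _ _)
    _ = ∫⁻ s in Set.Ioc (0 : ℝ) 1, ∫⁻ x in A,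
          ENNReal.ofReal (∑ k, w k ^ 2) * gsq g (x + s • w) := by
        rw [lintegral_lintegral_swap]
        fun_prop
    _ ≤ ∫⁻ _ in Set.Ioc (0 : ℝ) 1, ENNReal.ofReal (∑ k, w k ^ 2) * ∫⁻ x in T, gsq g x := by
        refine setLIntegral_mono' measurableSet_Ioc fun s hs => ?_
        rw [lintegral_const_mul _ (by fun_prop)]
        exact mul_le_mul_right (setLIntegral_comp_add_le (s • w) fun x hx => hT x hx s hs) _
    _ = _ := by simp

end Poincare

/-! ### Stability of the Scott–Zhang functional -/

section ScottZhang

theorem measurable_cellPoint (h : ℝ) (s : Fin d → Bool) (z : Fin d → ℝ) :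
    Measurable (cellPoint h s z) := by
  unfold cellPoint
  fun_prop

theorem map_cellPoint {h : ℝ} (hh : 0 < h) (s : Fin d → Bool) (z : Fin d → ℝ) :
    Measure.map (cellPoint h s z) volume = (ENNReal.ofReal (h ^ d))⁻¹ • volume := by
  set D : Fin d → ℝ := fun k => h * if s k then 1 else -1
  have habs : ∀ k, |D k| = h := by
    intro k
    by_cases hk : s k <;> simp [D, hk, abs_of_pos hh]
  have hdet : |(Matrix.diagonal D).det| = h ^ d := by
    rw [Matrix.det_diagonal, Finset.abs_prod]
    simp [habs]
  have hne : (Matrix.diagonal D).det ≠ 0 := by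
    rw [← abs_pos, hdet]
    positivity
  have h1 := Real.smul_map_diagonal_volume_pi hne
  rw [hdet] at h1
  have hc : ENNReal.ofReal (h ^ d) ≠ 0 := by
    rw [Ne, ENNReal.ofReal_eq_zero, not_le]
    positivity
  have h2 : Measure.map (Matrix.toLin' (Matrix.diagonal D)) volume
      = (ENNReal.ofReal (h ^ d))⁻¹ • volume := by
    conv_rhs => rw [← h1]
    rw [smul_smul, ENNReal.inv_mul_cancel hc ENNReal.ofReal_ne_top, one_smul]
  have h3 : cellPoint h s z = (fun x => x + z) ∘ Matrix.toLin' (Matrix.diagonal D) := by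
    ext t k
    simp [cellPoint, D, Matrix.mulVec_diagonal, add_comm]
  rw [h3, ← Measure.map_map (by fun_prop)
    (LinearMap.continuous_of_finiteDimensional _).measurable, h2, Measure.map_smul,
    map_add_right_eq_self]

/-- The cell at `z` lies in the cube of radius `h` about `z` for every choice of signs. Enlarging to
that cube makes the bound uniform in the choice, and the Jacobian gives `h^{-d}`. -/
theorem lintegral_comp_cellPoint_le {h : ℝ} (hh : 0 < h) (s : Fin d → Bool) (z : Fin d → ℝ)
    {f : (Fin d → ℝ) → ℝ≥0∞} (hf : Measurable f) :
    ∫⁻ t in Set.Icc (0 : Fin d → ℝ) 1, f (cellPoint h s z t) ≤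
      (ENNReal.ofReal (h ^ d))⁻¹ * ∫⁻ y in Set.Icc (fun k => z k - h) (fun k => z k + h), f y := by
  have hm := measurable_cellPoint h s z
  calc _ ≤ ∫⁻ t in cellPoint h s z ⁻¹' Set.Icc (fun k => z k - h) (fun k => z k + h),
        f (cellPoint h s z t) := by
        refine lintegral_mono_set fun t ht => ?_
        have h0 : ∀ k, 0 ≤ h * t k ∧ h * t k ≤ h := fun k =>
          ⟨mul_nonneg hh.le (ht.1 k), by
            have := mul_le_mul_of_nonneg_left (ht.2 k) hh.le
            simpa using this⟩
        constructor <;> intro k <;> have := h0 k <;> by_cases hk : s k <;>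
          simp only [cellPoint, hk, if_true] <;> norm_num <;> nlinarith
    _ = ∫⁻ y in Set.Icc (fun k => z k - h) (fun k => z k + h), f y
          ∂(Measure.map (cellPoint h s z) volume) :=
        (setLIntegral_map measurableSet_Icc hf hm).symm
    _ = _ := by
        rw [map_cellPoint hh, Measure.restrict_smul, lintegral_smul_measure, smul_eq_mul]

theorem ae_comp_cellPoint {h : ℝ} (hh : 0 < h) (s : Fin d → Bool) (z : Fin d → ℝ)
    {p : (Fin d → ℝ) → Prop} (hp : ∀ᵐ x, p x) : ∀ᵐ t, p (cellPoint h s z t) := by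
  have : Measure.QuasiMeasurePreserving (cellPoint h s z) volume volume := by
    refine ⟨measurable_cellPoint h s z, ?_⟩
    rw [map_cellPoint hh]
    exact Measure.smul_absolutelyContinuous
  exact this.ae hp

theorem szFunctional_congr {u u' : (Fin d → ℝ) → ℝ} {g g' : Fin d → (Fin d → ℝ) → ℝ}
    (hu : u =ᵐ[volume] u') (hg : ∀ k, g k =ᵐ[volume] g' k) {h : ℝ} (hh : 0 < h)
    (s : Fin d → Bool) (z : Fin d → ℝ) (o : Option (Fin d)) :
    szFunctional u g h s z o = szFunctional u' g' h s z o := by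
  have h1 := ae_comp_cellPoint hh s z hu
  cases o with
  | none =>
    refine integral_congr_ae (ae_restrict_of_ae ?_)
    filter_upwards [h1] with t ht
    rw [ht]
  | some k =>
    refine integral_congr_ae (ae_restrict_of_ae ?_)
    filter_upwards [h1, ae_comp_cellPoint hh s z (hg k)] with t ht ht'
    rw [ht, ht']

theorem volume_restrict_Icc_eq_pi :
    (volume : Measure (Fin d → ℝ)).restrict (Set.Icc 0 1)
      = Measure.pi fun _ => volume.restrict (Set.Icc (0 : ℝ) 1) := by
  rw [← Set.pi_univ_Icc, volume_pi, Measure.restrict_pi_pi]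
  rfl

instance : IsProbabilityMeasure (volume.restrict (Set.Icc (0 : ℝ) 1)) :=
  ⟨by simp⟩

instance : IsProbabilityMeasure ((volume : Measure (Fin d → ℝ)).restrict (Set.Icc 0 1)) := by
  rw [volume_restrict_Icc_eq_pi]
  infer_instance

/-- Each factor has mean `∫₀¹ (4 - 6t) dt = 1`. Constants are thus reproduced, also when the
direction normal to a face is left out of the product. -/
theorem integral_prod_four_sub (S : Finset (Fin d)) :
    ∫ t in Set.Icc (0 : Fin d → ℝ) 1, ∏ k ∈ S, (4 - 6 * t k) = 1 := by
  have h1 : ∀ t : Fin d → ℝ, ∏ k ∈ S, (4 - 6 * t k)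
      = ∏ k, (fun k (y : ℝ) => if k ∈ S then 4 - 6 * y else 1) k (t k) := by
    intro t
    simp
  rw [integral_congr_ae (Filter.Eventually.of_forall h1), volume_restrict_Icc_eq_pi,
    integral_fintype_prod_eq_prod (𝕜 := ℝ) (fun k (y : ℝ) => if k ∈ S then 4 - 6 * y else 1)]
  refine Finset.prod_eq_one fun k _ => ?_
  by_cases hk : k ∈ S
  · simp only [hk, if_true]
    rw [integral_Icc_eq_integral_Ioc, ← intervalIntegral.integral_of_le zero_le_one]
    rw [intervalIntegral.integral_sub (f := fun _ => 4) (g := fun x : ℝ => 6 * x) (by simp)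
      (Continuous.intervalIntegrable (by fun_prop) 0 1),
      intervalIntegral.integral_const_mul, integral_id]
    norm_num
  · simp [hk]

theorem abs_prod_four_sub_le (S : Finset (Fin d)) {t : Fin d → ℝ} (ht : t ∈ Set.Icc 0 1) :
    |∏ k ∈ S, (4 - 6 * t k)| ≤ 4 ^ d := by
  rw [Finset.abs_prod]
  calc ∏ k ∈ S, |4 - 6 * t k| ≤ ∏ _k ∈ S, (4 : ℝ) := by
        refine Finset.prod_le_prod (fun _ _ => abs_nonneg _) fun k _ => ?_
        have h1 := ht.1 k
        have h2 := ht.2 k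
        simp only [Pi.zero_apply, Pi.one_apply] at h1 h2
        rw [abs_le]
        constructor <;> linarith
    _ ≤ 4 ^ d := by
        rw [Finset.prod_const]
        refine pow_le_pow_right₀ (by norm_num) ?_
        simpa using S.card_le_univ

/-- Since the weight has integral one, `a` can be taken under the integral; then Jensen applies,
with the squared weight at most `(4^d)² = 16^d`. -/
theorem esq_sub_integral_prod_le (S : Finset (Fin d)) {v : (Fin d → ℝ) → ℝ}
    (hv : Integrable v (volume.restrict (Set.Icc (0 : Fin d → ℝ) 1))) (a : ℝ) :
    esq (a - ∫ t in Set.Icc (0 : Fin d → ℝ) 1, (∏ k ∈ S, (4 - 6 * t k)) * v t)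
      ≤ 16 ^ d * ∫⁻ t in Set.Icc (0 : Fin d → ℝ) 1, esq (a - v t) := by
  have hcont : Continuous fun t : Fin d → ℝ => ∏ k ∈ S, (4 - 6 * t k) := by fun_prop
  have hP : Integrable (fun t : Fin d → ℝ => ∏ k ∈ S, (4 - 6 * t k))
      (volume.restrict (Set.Icc (0 : Fin d → ℝ) 1)) :=
    hcont.continuousOn.integrableOn_compact isCompact_Icc
  have hPv : Integrable (fun t : Fin d → ℝ => (∏ k ∈ S, (4 - 6 * t k)) * v t)
      (volume.restrict (Set.Icc (0 : Fin d → ℝ) 1)) := by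
    refine hv.bdd_mul (c := 4 ^ d) hcont.aestronglyMeasurable ?_
    filter_upwards [ae_restrict_mem measurableSet_Icc] with t ht
    exact abs_prod_four_sub_le S ht
  have e : a - ∫ t in Set.Icc (0 : Fin d → ℝ) 1, (∏ k ∈ S, (4 - 6 * t k)) * v t
      = ∫ t in Set.Icc (0 : Fin d → ℝ) 1, (∏ k ∈ S, (4 - 6 * t k)) * (a - v t) := by
    simp_rw [mul_sub]
    rw [integral_sub (hP.mul_const a) hPv, integral_mul_const, integral_prod_four_sub, one_mul]
  have hm := hv.aestronglyMeasurable.aemeasurable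
  rw [e]
  calc _ ≤ ∫⁻ t in Set.Icc (0 : Fin d → ℝ) 1, esq ((∏ k ∈ S, (4 - 6 * t k)) * (a - v t)) :=
        esq_integral_le (hcont.measurable.aemeasurable.mul (hm.const_sub a))
    _ ≤ ∫⁻ t in Set.Icc (0 : Fin d → ℝ) 1, 16 ^ d * esq (a - v t) := by
        refine setLIntegral_mono' measurableSet_Icc fun t ht => ?_
        rw [esq_mul]
        gcongr
        refine (esq_mono (b := 4 ^ d) ?_).trans (le_of_eq ?_)
        · exact (abs_prod_four_sub_le S ht).trans (le_abs_self _)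
        · rw [esq, ← pow_mul, mul_comm, pow_mul, ENNReal.ofReal_pow (by norm_num)]
          norm_num
    _ = _ := lintegral_const_mul' _ _ (by finiteness)

theorem integrable_comp_cellPoint {f : (Fin d → ℝ) → ℝ} (hf : LocallyIntegrable f volume)
    (hfm : Measurable f) {h : ℝ} (hh : 0 < h) (s : Fin d → Bool) (z : Fin d → ℝ) :
    Integrable (fun t => f (cellPoint h s z t)) (volume.restrict (Set.Icc (0 : Fin d → ℝ) 1)) := by
  refine ⟨(hfm.comp (measurable_cellPoint h s z)).aestronglyMeasurable, ?_⟩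
  refine (lintegral_comp_cellPoint_le hh s z hfm.enorm).trans_lt (ENNReal.mul_lt_top ?_ ?_)
  · rw [lt_top_iff_ne_top, Ne, ENNReal.inv_eq_top, ENNReal.ofReal_eq_zero, not_le]
    positivity
  · exact (hf.integrableOn_isCompact isCompact_Icc).2

/-- The Scott-Zhang functional reproduces constants and is bounded on a cube of side `2h` around the
node. -/
theorem esq_sub_szFunctional_le {u : (Fin d → ℝ) → ℝ} {g : Fin d → (Fin d → ℝ) → ℝ}
    (hu : IsH1Per u g) (hum : Measurable u) (hgm : ∀ k, Measurable (g k)) {h : ℝ} (hh : 0 < h)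
    (s : Fin d → Bool) (z : Fin d → ℝ) (o : Option (Fin d)) (a : ℝ) :
    esq (a - szFunctional u g h s z o) ≤ 2 * 16 ^ d * ((ENNReal.ofReal (h ^ d))⁻¹ *
      ∫⁻ y in Set.Icc (fun k => z k - h) (fun k => z k + h),
        (esq (a - u y) + ENNReal.ofReal (h ^ 2) * gsq g y)) := by
  have hG := measurable_gsq hgm
  have hul := locallyIntegrable_of_periodic hum hu.periodic hu.memLp
  have hgl := fun k => locallyIntegrable_of_periodic (hgm k) (hu.periodic_grad k) (hu.memLp_grad k)
  -- Cells and faces have the same form: `v` is `u` with all factors for a cell, and the integrand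
  -- of the trace identity with the normal factor omitted for a face.
  have key : ∀ (S : Finset (Fin d)) (v : (Fin d → ℝ) → ℝ),
      Integrable v (volume.restrict (Set.Icc (0 : Fin d → ℝ) 1)) →
      (∀ t ∈ Set.Icc (0 : Fin d → ℝ) 1, esq (a - v t) ≤ 2 * (esq (a - u (cellPoint h s z t)) +
        ENNReal.ofReal (h ^ 2) * gsq g (cellPoint h s z t))) →
      esq (a - ∫ t in Set.Icc (0 : Fin d → ℝ) 1, (∏ k ∈ S, (4 - 6 * t k)) * v t) ≤
        2 * 16 ^ d * ((ENNReal.ofReal (h ^ d))⁻¹ *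
          ∫⁻ y in Set.Icc (fun k => z k - h) (fun k => z k + h),
            (esq (a - u y) + ENNReal.ofReal (h ^ 2) * gsq g y)) := by
    intro S v hv hle
    calc _ ≤ 16 ^ d * ∫⁻ t in Set.Icc (0 : Fin d → ℝ) 1, esq (a - v t) :=
          esq_sub_integral_prod_le S hv a
      _ ≤ 16 ^ d * ∫⁻ t in Set.Icc (0 : Fin d → ℝ) 1, 2 * (esq (a - u (cellPoint h s z t)) +
            ENNReal.ofReal (h ^ 2) * gsq g (cellPoint h s z t)) := by
          exact mul_le_mul_right (setLIntegral_mono' measurableSet_Icc hle) _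
      _ = 2 * 16 ^ d * ∫⁻ t in Set.Icc (0 : Fin d → ℝ) 1, (esq (a - u (cellPoint h s z t)) +
            ENNReal.ofReal (h ^ 2) * gsq g (cellPoint h s z t)) := by
          rw [lintegral_const_mul' _ _ (by simp), ← mul_assoc, mul_comm (16 ^ d)]
      _ ≤ _ := by
          exact mul_le_mul_right (lintegral_comp_cellPoint_le hh s z
            (f := fun y => esq (a - u y) + ENNReal.ofReal (h ^ 2) * gsq g y) (by fun_prop)) _
  cases o with
  | none =>
    refine key Finset.univ _ (integrable_comp_cellPoint hul hum hh s z) fun t _ => ?_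
    rw [mul_add]
    exact (le_mul_of_one_le_left' one_le_two).trans le_self_add
  | some k =>
    refine key (Finset.univ.erase k) _ ((integrable_comp_cellPoint hul hum hh s z).sub ?_)
      fun t ht => ?_
    · refine ((integrable_comp_cellPoint (hgl k) (hgm k) hh s z).const_mul _).bdd_mul (c := 1)
        (measurable_const.sub (measurable_pi_apply k)).aestronglyMeasurable ?_
      filter_upwards [ae_restrict_mem measurableSet_Icc] with t ht
      have h1 := ht.1 k
      have h2 := ht.2 k
      simp only [Pi.zero_apply, Pi.one_apply] at h1 h2
      rw [Real.norm_eq_abs, abs_le]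
      constructor <;> linarith
    · rw [← sub_add, mul_add]
      refine (esq_add_le _ _).trans ?_
      gcongr
      refine le_trans ?_ (mul_le_mul_right (esq_le_gsq g k _) _)
      rw [← mul_assoc, esq_mul]
      gcongr
      refine ENNReal.ofReal_le_ofReal (sq_le_sq.2 ?_)
      have h1 := ht.1 k
      have h2 := ht.2 k
      simp only [Pi.zero_apply, Pi.one_apply] at h1 h2
      rw [abs_mul, abs_mul]
      have h3 : |1 - t k| ≤ 1 := by rw [abs_le]; constructor <;> linarith
      have h4 : |(if s k then (1 : ℝ) else -1)| = 1 := by split <;> simp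
      rw [h4, mul_one]
      exact mul_le_of_le_one_left (abs_nonneg h) h3

end ScottZhang

/-! ### Pointwise comparison with finite element functions -/

section Pointwise

/-- Convexity of the square. Restricting the assumption to indices of nonzero weight is what
localizes the estimate to nodes near the point. -/
theorem esq_sub_convex_le {ι : Type*} (s : Finset ι) {w c : ι → ℝ} (hw : ∀ i ∈ s, 0 ≤ w i)
    (hw1 : ∑ i ∈ s, w i = 1) {a : ℝ} {F : ℝ≥0∞}
    (h : ∀ i ∈ s, w i ≠ 0 → esq (a - c i) ≤ F) : esq (a - ∑ i ∈ s, w i * c i) ≤ F := by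
  rcases eq_or_ne F ⊤ with rfl | hF
  · exact le_top
  have e : a - ∑ i ∈ s, w i * c i = ∑ i ∈ s, w i * (a - c i) := by
    simp_rw [mul_sub, Finset.sum_sub_distrib, ← Finset.sum_mul, hw1, one_mul]
  rw [e, esq, ENNReal.ofReal_le_iff_le_toReal hF]
  calc (∑ i ∈ s, w i * (a - c i)) ^ 2 ≤ ∑ i ∈ s, w i * (a - c i) ^ 2 :=
        Real.pow_arith_mean_le_arith_mean_pow_of_even s w _ hw hw1 even_two
    _ ≤ ∑ i ∈ s, w i * F.toReal := by
        refine Finset.sum_le_sum fun i hi => ?_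
        rcases eq_or_ne (w i) 0 with h0 | h0
        · simp [h0]
        · exact mul_le_mul_of_nonneg_left
            ((ENNReal.ofReal_le_iff_le_toReal hF).1 (h i hi h0)) (hw i hi)
    _ = F.toReal := by rw [← Finset.sum_mul, hw1, one_mul]

theorem hat_nonneg (t : ℝ) : 0 ≤ hat t := le_max_left _ _

theorem hat_eq_zero {t : ℝ} (ht : 1 ≤ |t|) : hat t = 0 := max_eq_left (by linarith)

theorem hat_eq {t : ℝ} (ht : |t| ≤ 1) : hat t = 1 - |t| := max_eq_right (by linarith)

/-- Partition of unity: on `[N, N+1]` only the hats at the two end points are alive, and their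
values are complementary. -/
theorem sum_hat_sub (N : ℕ) {t : ℝ} (h0 : 0 ≤ t) (hN : t ≤ N) :
    ∑ j ∈ Finset.range (N + 1), hat (t - j) = 1 := by
  induction N with
  | zero =>
    have : t = 0 := le_antisymm (by simpa using hN) h0
    simp [this, hat]
  | succ N ih =>
    rw [Finset.sum_range_succ]
    push_cast at hN ⊢
    rcases le_total t N with h | h
    · rw [ih h, hat_eq_zero, add_zero]
      rw [abs_of_nonpos (by linarith)]
      linarith
    · rw [Finset.sum_range_succ, Finset.sum_eq_zero, hat_eq, hat_eq, abs_of_nonneg, abs_of_nonpos]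
      · ring
      · linarith
      · linarith
      · rw [abs_le]; constructor <;> linarith
      · rw [abs_le]; constructor <;> linarith
      · intro j hj
        refine hat_eq_zero ?_
        have : (j : ℝ) + 1 ≤ N := by exact_mod_cast Finset.mem_range.1 hj
        rw [abs_of_nonneg (by linarith)]
        linarith

theorem meshSize_mul {n : ℕ} {N : Block d → ℕ} {B : Block d} (hN : 0 < N B) :
    meshSize n N B * N B = eps n * B.size := by
  have : (N B : ℝ) ≠ 0 := by positivity
  rw [meshSize, div_mul_cancel₀ _ this]

theorem node_mem_alphaCube {n : ℕ} {N : Block d → ℕ} {B : Block d} (hN : 0 < N B)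
    (hh : 0 < meshSize n N B) (i : Fin d → Fin (N B + 1)) : node n N B i ∈ B.alphaCube n 0 := by
  intro k
  have h1 : ((i k : ℕ) : ℝ) ≤ N B := by exact_mod_cast Nat.lt_succ_iff.1 (i k).2
  have h2 := mul_le_mul_of_nonneg_left h1 hh.le
  have h3 : 0 ≤ meshSize n N B * (i k : ℕ) := by positivity
  rw [meshSize_mul hN] at h2
  simp only [node, mul_add]
  constructor <;> linarith

/-- On the cube the tensor hats are nonnegative, sum to one and vanish beyond one mesh width, so the
value is a convex combination of nearby nodal values. -/
theorem esq_sub_q1Block_le {n : ℕ} {N : Block d → ℕ} {B : Block d} (hN : 0 < N B)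
    (hh : 0 < meshSize n N B) {x : Fin d → ℝ} (hx : x ∈ B.alphaCube n 0)
    (c : (Fin d → ℝ) → ℝ) {a : ℝ} {F : ℝ≥0∞}
    (H : ∀ i, (∀ k, |x k - node n N B i k| ≤ meshSize n N B) → esq (a - c (node n N B i)) ≤ F) :
    esq (a - q1Block n N c B x) ≤ F := by
  have e : q1Block n N c B x = ∑ i : Fin d → Fin (N B + 1),
      (∏ k, hat ((x k - node n N B i k) / meshSize n N B)) * c (node n N B i) :=
    Finset.sum_congr rfl fun i _ => mul_comm _ _
  rw [e]
  refine esq_sub_convex_le _ (fun i _ => Finset.prod_nonneg fun k _ => hat_nonneg _) ?_ ?_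
  · have h1 : ∀ i : Fin d → Fin (N B + 1), ∏ k, hat ((x k - node n N B i k) / meshSize n N B)
        = ∏ k, (fun k (j : Fin (N B + 1)) =>
          hat ((x k - eps n * B.corner k) / meshSize n N B - (j : ℕ))) k (i k) := by
      intro i
      refine Finset.prod_congr rfl fun k _ => ?_
      simp only [node]
      congr 1
      field_simp
      ring
    rw [Finset.sum_congr rfl fun i _ => h1 i, ← Fintype.prod_sum (fun k (j : Fin (N B + 1)) =>
      hat ((x k - eps n * B.corner k) / meshSize n N B - (j : ℕ)))]
    refine Finset.prod_eq_one fun k _ => ?_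
    have hk := hx k
    rw [Fin.sum_univ_eq_sum_range
      (fun j => hat ((x k - eps n * B.corner k) / meshSize n N B - (j : ℝ)))]
    refine sum_hat_sub _ (div_nonneg (by linarith) hh.le) ?_
    rw [div_le_iff₀ hh]
    linarith [meshSize_mul (n := n) hN]
  · intro i _ hi
    refine H i fun k => ?_
    have h1 := (Finset.prod_ne_zero_iff.1 hi) k (Finset.mem_univ k)
    by_contra hlt
    refine h1 (hat_eq_zero ?_)
    rw [abs_div, abs_of_pos hh, le_div_iff₀ hh, one_mul]
    exact (not_le.1 hlt).le

/-- One coordinate of the layer interpolation. Interpolation points that carry weight must not leave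
the `δ`-neighbourhood of the interval; otherwise they might hit a cube that does not touch the block
and has an unrelated mesh. -/
theorem fine_cell_bounds {a h δ y : ℝ} {N : ℕ} (hδ : 0 < δ) (hδh : 2 * δ ≤ h)
    (hy0 : a - δ ≤ y) (hy1 : y ≤ a + h * N + δ) {r lo hi : ℝ} (hr : r = gridRem a h y)
    (hlo : lo = subLo δ h r) (hhi : hi = subHi δ h r) :
    lo ≤ r ∧ r ≤ hi ∧ lo < hi ∧ 0 ≤ lo ∧ hi ≤ h ∧ 0 ≤ r ∧ r ≤ h ∧
      (hi - r ≠ 0 → a - δ ≤ y - r + lo ∧ y - r + lo ≤ a + h * N + δ) ∧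
      (r - lo ≠ 0 → a - δ ≤ y - r + hi ∧ y - r + hi ≤ a + h * N + δ) := by
  have hh : 0 < h := by linarith
  set z : ℤ := ⌊(y - a) / h⌋ with hz
  have hyr : y - r = a + h * z := by rw [hr, gridRem]; ring
  have hr0 : 0 ≤ r := by
    have := Int.floor_le ((y - a) / h)
    rw [le_div_iff₀ hh] at this
    nlinarith
  have hr1 : r < h := by
    have := Int.lt_floor_add_one ((y - a) / h)
    rw [div_lt_iff₀ hh] at this
    nlinarith
  have hz1 : -1 ≤ z := by
    by_contra hlt
    have h1 : z ≤ -2 := by omega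
    have h2 : (z : ℝ) ≤ -2 := by exact_mod_cast h1
    nlinarith
  have hz2 : z ≤ N := by
    by_contra hlt
    have h1 : (N : ℤ) + 1 ≤ z := by omega
    have h2 : (N : ℝ) + 1 ≤ z := by exact_mod_cast h1
    nlinarith
  -- The point lies in the layer before the interval, in the layer behind it, or in a full mesh
  -- interval.
  have hcase : (z = -1 ∧ h - δ ≤ r) ∨ (z = N ∧ r ≤ δ) ∨
      (0 ≤ h * (z : ℝ) ∧ h * (z : ℝ) + h ≤ h * N) := by
    rcases eq_or_lt_of_le hz1 with h1 | h1
    · left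
      refine ⟨h1.symm, ?_⟩
      rw [← h1] at hyr
      push_cast at hyr
      linarith
    · rcases eq_or_lt_of_le hz2 with h2 | h2
      · right; left
        refine ⟨h2, ?_⟩
        rw [h2] at hyr
        push_cast at hyr
        linarith
      · right; right
        have h3 : (0 : ℝ) ≤ z := by
          have : 0 ≤ z := by omega
          exact_mod_cast this
        have h4 : (z : ℝ) + 1 ≤ N := by
          have : z + 1 ≤ (N : ℤ) := by omega
          exact_mod_cast this
        constructor <;> nlinarith
  have hN : 0 ≤ h * (N : ℝ) := by positivity
  rw [hyr]
  subst hlo hhi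
  unfold subLo subHi
  rcases hcase with ⟨h1, h2⟩ | ⟨h1, h2⟩ | ⟨h1, h2⟩
  · have e1 : ¬ r < δ := by linarith
    have e2 : ¬ r < h - δ := by linarith
    have e3 : (z : ℝ) = -1 := by rw [h1]; norm_num
    simp only [e1, e2, if_false, e3]
    refine ⟨by linarith, by linarith, by linarith, by linarith, by linarith, hr0, hr1.le,
      fun _ => ⟨by linarith, by linarith⟩, fun _ => ⟨by linarith, by linarith⟩⟩
  · have e3 : (z : ℝ) = N := by rw [h1]; norm_num
    rw [e3]
    by_cases e1 : r < δ
    · simp only [e1, if_true]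
      refine ⟨by linarith, by linarith, by linarith, by linarith, by linarith, hr0, hr1.le,
        fun _ => ⟨by linarith, by linarith⟩, fun _ => ⟨by linarith, by linarith⟩⟩
    -- On the outer boundary the point is assigned to the next part of the subdivision, whose right
    -- end is outside; that end has weight zero.
    · have e4 : r = δ := le_antisymm h2 (not_lt.1 e1)
      by_cases e2 : r < h - δ
      · simp only [e1, e2, if_false, if_true]
        refine ⟨by linarith, by linarith, by linarith, by linarith, by linarith, hr0, hr1.le,
          fun _ => ⟨by linarith, by linarith⟩, fun hne => absurd (by linarith) hne⟩
      · simp only [e1, e2, if_false]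
        refine ⟨by linarith, by linarith, by linarith, by linarith, by linarith, hr0, hr1.le,
          fun _ => ⟨by linarith, by linarith⟩, fun hne => absurd (by linarith) hne⟩
  · split_ifs with e1 e2 <;>
    refine ⟨by linarith, by linarith, by linarith, by linarith, by linarith, hr0, hr1.le,
      fun _ => ⟨by linarith, by linarith⟩, fun _ => ⟨by linarith, by linarith⟩⟩

theorem eps_pos {n : ℕ} (hn : 0 < n) : 0 < eps n := by unfold eps; positivity

theorem esq_sub_fineInterp_le {n : ℕ} (hn : 0 < n) {N : Block d → ℕ} {B : Block d} (hN : 0 < N B)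
    (hh : eps n ≤ meshSize n N B) {x : Fin d → ℝ} (hx : x ∈ B.alphaCube n (eps n / 2))
    (f : (Fin d → ℝ) → ℝ) {a : ℝ} {F : ℝ≥0∞}
    (H : ∀ p ∈ B.alphaCube n (eps n / 2), (∀ k, |x k - p k| ≤ meshSize n N B) →
      esq (a - f p) ≤ F) :
    esq (a - fineInterp n N B f x) ≤ F := by
  have he := eps_pos hn
  set r : Fin d → ℝ := fun k => gridRem (eps n * B.corner k) (meshSize n N B) (x k) with hr
  set lo : Fin d → ℝ := fun k => subLo (eps n / 2) (meshSize n N B) (r k) with hlo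
  set hi : Fin d → ℝ := fun k => subHi (eps n / 2) (meshSize n N B) (r k) with hhi
  have hb : ∀ k, _ := fun k => fine_cell_bounds (a := eps n * B.corner k) (h := meshSize n N B)
    (δ := eps n / 2) (y := x k) (N := N B) (by linarith) (by linarith) (hx k).1
    (by rw [meshSize_mul hN]; linarith [(hx k).2]) (r := r k) (lo := lo k) (hi := hi k) rfl rfl rfl
  change esq (a - ∑ s : Fin d → Bool,
    (∏ k, if s k then (r k - lo k) / (hi k - lo k) else (hi k - r k) / (hi k - lo k)) *
      f (fun k => x k - r k + if s k then hi k else lo k)) ≤ F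
  refine esq_sub_convex_le _ ?_ ?_ ?_
  · intro s _
    refine Finset.prod_nonneg fun k _ => ?_
    obtain ⟨h1, h2, h3, -⟩ := hb k
    split_ifs <;> exact div_nonneg (by linarith) (by linarith)
  · rw [← Fintype.prod_sum (fun k (b : Bool) => if b then (r k - lo k) / (hi k - lo k)
      else (hi k - r k) / (hi k - lo k))]
    refine Finset.prod_eq_one fun k _ => ?_
    obtain ⟨h1, h2, h3, -⟩ := hb k
    rw [Fintype.sum_bool]
    simp only [if_true, Bool.false_eq_true, if_false]
    rw [← add_div, div_eq_one_iff_eq (by linarith)]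
    ring
  · intro s _ hs
    refine H _ (fun k => ?_) fun k => ?_
    · have hk := Finset.prod_ne_zero_iff.1 hs k (Finset.mem_univ k)
      obtain ⟨-, -, -, -, -, -, -, h1, h2⟩ := hb k
      rw [meshSize_mul hN] at h1 h2
      by_cases hsk : s k
      · simp only [hsk, if_true] at hk ⊢
        have := h2 fun h0 => hk (by rw [h0, zero_div])
        constructor <;> linarith [this.1, this.2]
      · simp only [hsk, if_false, Bool.false_eq_true] at hk ⊢
        have := h1 fun h0 => hk (by rw [h0, zero_div])
        constructor <;> linarith [this.1, this.2]
    · obtain ⟨h1, h2, h3, h4, h5, h6, h7, -⟩ := hb k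
      by_cases hsk : s k <;> simp only [hsk, if_true, if_false, Bool.false_eq_true] <;>
        rw [abs_le] <;> constructor <;> linarith

theorem alphaCube_inter_nonempty {n : ℕ} (hn : 0 < n) {B B' : Block d}
    (h1 : ∀ k, B.corner k ≤ B'.corner k + B'.size) (h2 : ∀ k, B'.corner k ≤ B.corner k + B.size) :
    (B.alphaCube n 0 ∩ B'.alphaCube n 0).Nonempty := by
  have he := (eps_pos hn).le
  have key : ∀ a b : ℤ, a ≤ b → eps n * (a : ℝ) ≤ eps n * (b : ℝ) := fun a b hab =>
    mul_le_mul_of_nonneg_left (by exact_mod_cast hab) he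
  refine ⟨fun k => eps n * (max (B.corner k) (B'.corner k) : ℤ), fun k => ?_, fun k => ?_⟩
  · have i1 := key _ _ (le_max_left (B.corner k) (B'.corner k))
    have i2 := key (max (B.corner k) (B'.corner k)) (B.corner k + B.size) (max_le (by omega) (h2 k))
    push_cast at i1 i2 ⊢
    constructor <;> linarith
  · have i1 := key _ _ (le_max_right (B.corner k) (B'.corner k))
    have i2 := key (max (B.corner k) (B'.corner k)) (B'.corner k + B'.size) (max_le (h1 k) (by omega))
    push_cast at i1 i2 ⊢
    constructor <;> linarith

/-- Corners are multiples of `ε`, so a gap of at most `ε/2` in a coordinate is no gap. This gives a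
common mesh for a block and any cube met by its layer. -/
theorem alphaCube_inter_nonempty_of_mem {n : ℕ} (hn : 0 < n) {B B' : Block d} {p : Fin d → ℝ}
    (hp : p ∈ B.alphaCube n (eps n / 2)) (hp' : p ∈ B'.alphaCube n 0) :
    (B.alphaCube n 0 ∩ B'.alphaCube n 0).Nonempty := by
  have he := eps_pos hn
  have key : ∀ a b : ℤ, eps n * (a : ℝ) ≤ eps n * (b : ℝ) + eps n / 2 → a ≤ b := by
    intro a b hab
    have h1 : (a : ℝ) ≤ b + 1 / 2 := by
      refine le_of_mul_le_mul_left ?_ he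
      linarith
    by_contra hlt
    have h2 : (b : ℝ) + 1 ≤ a := by exact_mod_cast (not_le.1 hlt)
    linarith
  refine alphaCube_inter_nonempty hn (fun k => key _ _ ?_) fun k => key _ _ ?_ <;>
  · have i1 := hp k
    have i2 := hp' k
    push_cast
    linarith [i1.1, i1.2, i2.1, i2.2]

open Classical in
/-- Pointwise comparison of a number with the finite element function with nodal values `c`. -/
theorem esq_sub_extend_le {n ℓ : ℕ} (hn : 0 < n) {𝓑 : Set (Block d)} {cm : ℝ} {N : Block d → ℕ}
    (hN : IsMesh n ℓ 𝓑 cm N) (c : (Fin d → ℝ) → ℝ) (x : Fin d → ℝ) (a : ℝ) (F : Block d → ℝ≥0∞)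
    (H : ∀ B ∈ large ℓ 𝓑, x ∈ B.alphaCube n (eps n / 2) → ∀ B' ∈ large ℓ 𝓑,
      meshSize n N B' = meshSize n N B → ∀ i : Fin d → Fin (N B' + 1),
      (∀ k, |x k - node n N B' i k| ≤ 2 * meshSize n N B) → esq (a - c (node n N B' i)) ≤ F B) :
    esq (a - extend n ℓ 𝓑 N c x) ≤ (if x ∈ largeAlpha n ℓ 𝓑 then 0 else esq a) +
      ∑' B : Block d, if B ∈ large ℓ 𝓑 ∧ x ∈ B.alphaCube n (eps n / 2) then F B else 0 := by
  have he := eps_pos hn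
  have hpos : ∀ B ∈ large ℓ 𝓑, 0 < meshSize n N B := fun B hB => he.trans_le (hN.le_meshSize B hB)
  -- The block chosen in the definition of the extension is dominated by a sum over all blocks,
  -- which does not depend on the choice and can be integrated.
  have hsum : ∀ B ∈ large ℓ 𝓑, x ∈ B.alphaCube n (eps n / 2) → F B ≤
      ∑' B : Block d, if B ∈ large ℓ 𝓑 ∧ x ∈ B.alphaCube n (eps n / 2) then F B else 0 := by
    intro B hB hx
    refine le_trans (le_of_eq ?_) (ENNReal.le_tsum B)
    rw [if_pos ⟨hB, hx⟩]
  rw [extend]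
  by_cases hx : x ∈ largeAlpha n ℓ 𝓑
  · have hx' : ∃ B ∈ large ℓ 𝓑, x ∈ B.alphaCube n 0 := hx
    rw [if_pos hx, if_pos hx, zero_add, q1Large, dif_pos hx']
    obtain ⟨hB, hxB⟩ := hx'.choose_spec
    have hxB' : x ∈ hx'.choose.alphaCube n (eps n / 2) := fun k =>
      ⟨by linarith [(hxB k).1], by linarith [(hxB k).2]⟩
    refine le_trans ?_ (hsum _ hB hxB')
    refine esq_sub_q1Block_le (hN.pos _ hB) (hpos _ hB) hxB c fun i hi => ?_
    exact H _ hB hxB' _ hB rfl i fun k => (hi k).trans (by linarith [hpos _ hB])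
  · rw [if_neg hx, if_neg hx]
    split_ifs with hx'
    · obtain ⟨hB, hxB⟩ := hx'.choose_spec
      refine le_trans ?_ (add_le_add_right (hsum _ hB hxB) _)
      -- The factor `2` in the distance arises here: one mesh width from `x` to an interpolation
      -- point `p`, another from `p` to a node.
      refine esq_sub_fineInterp_le hn (hN.pos _ hB) (hN.le_meshSize _ hB) hxB _ fun p hp hxp => ?_
      rw [q1Large]
      split_ifs with hp'
      · obtain ⟨hB', hpB'⟩ := hp'.choose_spec
        have hconf := (hN.conform _ hB _ hB' (alphaCube_inter_nonempty_of_mem hn hp hpB')).1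
        refine le_trans ?_ le_add_self
        refine esq_sub_q1Block_le (hN.pos _ hB') (hpos _ hB') hpB' c fun i hi => ?_
        refine H _ hB hxB _ hB' hconf.symm i fun k => ?_
        have i1 := hxp k
        have i2 := hi k
        rw [← hconf] at i2
        rw [abs_le] at i1 i2 ⊢
        constructor <;> linarith [i1.1, i1.2, i2.1, i2.2]
      -- The interpolation point carries the value zero; the resulting `|a|²` is admitted because
      -- `x` is not in a large `α`-cube.
      · rw [sub_zero]
        exact le_self_add
    · rw [sub_zero]
      exact le_self_add

end Pointwise

/-! ### Geometry of the domino tiling -/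

section Geometry

instance : Countable (Block d) := by
  have : Function.Injective fun B : Block d => (B.size, B.corner, B.axis, B.up) := by
    rintro ⟨⟩ ⟨⟩ h
    simpa using h
  exact this.countable

/-- The cell of the background partition that contains `x`. -/
def cellIndex (n : ℕ) (x : Fin d → ℝ) : Fin d → ℤ := fun k => ⌊n * x k⌋

theorem measurable_cellIndex (n : ℕ) : Measurable (cellIndex (d := d) n) := by
  unfold cellIndex
  exact measurable_pi_lambda _ fun k => Int.measurable_floor.comp (by fun_prop)

/-- The half-open `α`-cube of a block. -/
def alphaSet (n : ℕ) (B : Block d) : Set (Fin d → ℝ) := cellIndex n ⁻¹' B.alphaCells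

/-- The half-open `β`-cube of a block. -/
def betaSet (n : ℕ) (B : Block d) : Set (Fin d → ℝ) := cellIndex n ⁻¹' B.betaCells

theorem measurableSet_alphaSet (n : ℕ) (B : Block d) : MeasurableSet (alphaSet n B) :=
  measurable_cellIndex n (Set.to_countable _).measurableSet

theorem measurableSet_betaSet (n : ℕ) (B : Block d) : MeasurableSet (betaSet n B) :=
  measurable_cellIndex n (Set.to_countable _).measurableSet

theorem isClosed_alphaCube (n : ℕ) (r : ℝ) (B : Block d) : IsClosed (B.alphaCube n r) := by
  have : B.alphaCube n r = Set.Icc (fun k => eps n * B.corner k - r)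
      (fun k => eps n * (B.corner k + B.size) + r) := by
    ext x
    simp only [Block.alphaCube, Set.mem_ofPred_eq, Set.mem_Icc, Pi.le_def, forall_and]
  rw [this]
  exact isClosed_Icc

theorem measurableSet_largeAlpha (n ℓ : ℕ) (𝓑 : Set (Block d)) :
    MeasurableSet (largeAlpha n ℓ 𝓑) := by
  have : largeAlpha n ℓ 𝓑 = ⋃ B ∈ large ℓ 𝓑, B.alphaCube n 0 := by
    ext x
    simp [largeAlpha]
  rw [this]
  exact MeasurableSet.biUnion (Set.to_countable _) fun B _ => (isClosed_alphaCube n 0 B).measurableSet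

theorem eps_mul_self {n : ℕ} (hn : 0 < n) (y : ℝ) : eps n * (n * y) = y := by
  have : (n : ℝ) ≠ 0 := by positivity
  rw [eps]
  field_simp

theorem eps_mul_le_iff {n : ℕ} (hn : 0 < n) (a y : ℝ) : eps n * a ≤ y ↔ a ≤ n * y := by
  have : (0 : ℝ) < n := by positivity
  rw [eps, one_div, inv_mul_le_iff₀ this]

theorem le_eps_mul_iff {n : ℕ} (hn : 0 < n) (a y : ℝ) : y ≤ eps n * a ↔ n * y ≤ a := by
  have : (0 : ℝ) < n := by positivity
  rw [eps, one_div, le_inv_mul_iff₀ this]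

theorem alphaSet_subset_alphaCube {n : ℕ} (hn : 0 < n) (B : Block d) :
    alphaSet n B ⊆ B.alphaCube n 0 := by
  intro x hx k
  obtain ⟨h1, h2⟩ := hx k
  rw [cellIndex, Int.le_floor] at h1
  rw [cellIndex, Int.floor_lt] at h2
  push_cast at h2
  rw [sub_zero, add_zero, eps_mul_le_iff hn, le_eps_mul_iff hn]
  exact ⟨h1, h2.le⟩

/-- The points that lie on no hyperplane `2 n xₖ ∈ ℤ`. -/
def IsGeneric (n : ℕ) (x : Fin d → ℝ) : Prop := ∀ k, ∀ m : ℤ, 2 * n * x k ≠ m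

theorem ae_isGeneric {n : ℕ} (hn : 0 < n) : ∀ᵐ x : Fin d → ℝ, IsGeneric n x := by
  have hn' : (n : ℝ) ≠ 0 := by positivity
  unfold IsGeneric
  rw [ae_all_iff]
  intro k
  rw [ae_all_iff]
  intro m
  have h := Measure.ae_eval_ne (μ := fun _ : Fin d => (volume : Measure ℝ)) k
    (m / (2 * n))
  rw [← volume_pi] at h
  filter_upwards [h] with x hx heq
  refine hx ?_
  rw [← heq]
  field_simp

theorem IsGeneric.mem_alphaSet {n : ℕ} (hn : 0 < n) {x : Fin d → ℝ} (hx : IsGeneric n x)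
    {B : Block d} (hB : x ∈ B.alphaCube n 0) : x ∈ alphaSet n B := by
  intro k
  have h := hB k
  rw [sub_zero, add_zero, eps_mul_le_iff hn, le_eps_mul_iff hn] at h
  refine ⟨Int.le_floor.2 h.1, Int.floor_lt.2 ?_⟩
  push_cast
  refine lt_of_le_of_ne h.2 fun heq => hx k (2 * (B.corner k + B.size)) ?_
  push_cast
  rw [mul_assoc, heq]

/-- Disjoint closed cubes are at least `ε` apart in some coordinate, so their `ε/2`-neighbourhoods
can meet only where `n xₖ` is a half-integer. This is why `IsGeneric` contains the factor `2`. -/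
theorem IsGeneric.inter_nonempty {n : ℕ} (hn : 0 < n) {x : Fin d → ℝ} (hx : IsGeneric n x)
    {B B' : Block d} (hB : x ∈ B.alphaCube n (eps n / 2)) (hB' : x ∈ B'.alphaCube n (eps n / 2)) :
    (B.alphaCube n 0 ∩ B'.alphaCube n 0).Nonempty := by
  have he := eps_pos hn
  have key : ∀ k (a b : ℤ), eps n * (a : ℝ) - eps n / 2 ≤ x k →
      x k ≤ eps n * (b : ℝ) + eps n / 2 → a ≤ b := by
    intro k a b h1 h2
    have h1' : (a : ℝ) - 1 / 2 ≤ n * x k := (eps_mul_le_iff hn _ _).1 (by linarith)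
    have h2' : n * x k ≤ (b : ℝ) + 1 / 2 := (le_eps_mul_iff hn _ _).1 (by linarith)
    by_contra hlt
    have h3 : (b : ℝ) + 1 ≤ a := by exact_mod_cast (not_le.1 hlt)
    refine hx k (2 * b + 1) ?_
    push_cast
    linarith
  refine alphaCube_inter_nonempty hn (fun k => key k _ _ (hB k).1 ?_)
    fun k => key k _ _ (hB' k).1 ?_
  · push_cast
    exact (hB' k).2
  · push_cast
    exact (hB k).2

/-- The translation that maps the `α`-cube of a block to its `β`-cube. -/
def Block.translation (n : ℕ) (B : Block d) : Fin d → ℝ :=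
  Pi.single B.axis (if B.up then eps n * B.size else -(eps n * B.size))

/-- Only the coordinate along the axis moves, by at most one edge, and the half-open cubes fit
together without a gap. The segments used for Friedrichs' inequality hence stay in the block. -/
theorem add_smul_translation_mem {n : ℕ} (hn : 0 < n) {B : Block d} {x : Fin d → ℝ}
    (hx : x ∈ alphaSet n B) {s : ℝ} (hs : s ∈ Set.Icc (0 : ℝ) 1) :
    x + s • B.translation n ∈ alphaSet n B ∪ betaSet n B := by
  have hne : (n : ℝ) * eps n = 1 := by
    have := eps_mul_self hn 1
    rw [mul_one] at this
    rw [mul_comm, this]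
  have hoff : ∀ k, k ≠ B.axis → (x + s • B.translation n) k = x k := by
    intro k hk
    simp [Block.translation, hk]
  have hsz0 : (0 : ℝ) ≤ B.size := Nat.cast_nonneg _
  have hs1 : 0 ≤ s * B.size := mul_nonneg hs.1 hsz0
  have hs2 : s * B.size ≤ B.size := mul_le_of_le_one_left hsz0 hs.2
  obtain ⟨h1, h2⟩ := hx B.axis
  rw [cellIndex, Int.le_floor] at h1
  rw [cellIndex, Int.floor_lt] at h2
  push_cast at h2
  by_cases hup : B.up
  · have hax : n * (x + s • B.translation n) B.axis = n * x B.axis + s * B.size := by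
      simp only [Block.translation, Pi.add_apply, Pi.smul_apply, Pi.single_eq_same, hup, if_true,
        smul_eq_mul]
      linear_combination s * B.size * hne
    by_cases hc : n * x B.axis + s * B.size < B.corner B.axis + B.size
    · left
      intro k
      by_cases hk : k = B.axis
      · subst hk
        rw [cellIndex, Int.le_floor, Int.floor_lt, hax]
        push_cast
        constructor <;> linarith
      · rw [cellIndex, hoff k hk]
        exact hx k
    · right
      intro k
      by_cases hk : k = B.axis
      · subst hk
        rw [cellIndex, Int.le_floor, Int.floor_lt, hax]
        simp only [Block.betaCorner, hup, if_true, Pi.add_apply, Pi.single_eq_same]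
        push_cast
        constructor <;> linarith
      · rw [cellIndex, hoff k hk]
        have := hx k
        simpa [Block.betaCorner, hk, cellIndex] using this
  · have hax : n * (x + s • B.translation n) B.axis = n * x B.axis - s * B.size := by
      simp only [Block.translation, Pi.add_apply, Pi.smul_apply, Pi.single_eq_same, hup, if_false,
        smul_eq_mul, Bool.false_eq_true]
      linear_combination - s * B.size * hne
    by_cases hc : B.corner B.axis ≤ n * x B.axis - s * B.size
    · left
      intro k
      by_cases hk : k = B.axis
      · subst hk
        rw [cellIndex, Int.le_floor, Int.floor_lt, hax]
        push_cast
        constructor <;> linarith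
      · rw [cellIndex, hoff k hk]
        exact hx k
    · right
      intro k
      by_cases hk : k = B.axis
      · subst hk
        rw [cellIndex, Int.le_floor, Int.floor_lt, hax]
        simp only [Block.betaCorner, hup, if_false, Pi.add_apply, Pi.single_eq_same,
          Bool.false_eq_true]
        push_cast
        constructor <;> linarith
      · rw [cellIndex, hoff k hk]
        have := hx k
        simpa [Block.betaCorner, hk, cellIndex] using this

theorem disjoint_alphaCells_betaCells (B : Block d) : Disjoint B.alphaCells B.betaCells := by
  rw [Set.disjoint_left]
  intro q h1 h2
  have i1 := h1 B.axis
  have i2 := h2 B.axis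
  by_cases hup : B.up <;> simp only [Block.betaCorner, Pi.add_apply, Pi.single_eq_same, hup,
    if_true, if_false, Bool.false_eq_true] at i2 <;> omega

theorem add_translation_mem {n : ℕ} (hn : 0 < n) {B : Block d} {x : Fin d → ℝ}
    (hx : x ∈ alphaSet n B) : x + B.translation n ∈ betaSet n B := by
  have h := add_smul_translation_mem hn hx (s := 1) (by simp)
  rw [one_smul] at h
  refine h.resolve_left fun h' => ?_
  have hne : (n : ℝ) * eps n = 1 := by
    have := eps_mul_self hn 1
    rw [mul_one] at this
    rw [mul_comm, this]
  obtain ⟨h1, h2⟩ := hx B.axis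
  obtain ⟨h3, h4⟩ := h' B.axis
  rw [cellIndex, Int.le_floor] at h1 h3
  rw [cellIndex, Int.floor_lt] at h2 h4
  push_cast at h2 h4
  by_cases hup : B.up
  · have hax : n * (x + B.translation n) B.axis = n * x B.axis + B.size := by
      simp only [Block.translation, Pi.add_apply, Pi.single_eq_same, hup, if_true]
      linear_combination B.size * hne
    linarith
  · have hax : n * (x + B.translation n) B.axis = n * x B.axis - B.size := by
      simp only [Block.translation, Pi.add_apply, Pi.single_eq_same, hup, if_false,
        Bool.false_eq_true]
      linear_combination - B.size * hne
    linarith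

/-- A block of more than `n` cells per edge would share a cell with its own translate by `(1,…,1)`.
Hence all edges have length at most one. -/
theorem IsTiling.size_le {n L : ℕ} (hn : 0 < n) {𝓑 : Set (Block d)} (h : IsTiling n L 𝓑)
    {B : Block d} (hB : B ∈ 𝓑) : B.size ≤ n := by
  by_contra hlt
  rw [not_le] at hlt
  obtain ⟨B₀, -, huniq⟩ := h.tiles (fun k => B.corner k + n * (1 : Fin d → ℤ) k)
  have e1 := huniq B ⟨hB, Or.inl fun k => by simp; omega⟩
  have e2 := huniq (B.shift n 1) ⟨h.shift_mem B hB 1, Or.inl fun k => by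
    simp [Block.shift]; omega⟩
  have e3 := congrArg (fun B : Block d => B.corner B.axis) (e1.trans e2.symm)
  simp [Block.shift] at e3
  omega

theorem IsTiling.eq_of_mem {n L : ℕ} {𝓑 : Set (Block d)} (h : IsTiling n L 𝓑) {B B' : Block d}
    (hB : B ∈ 𝓑) (hB' : B' ∈ 𝓑) {q : Fin d → ℤ} (hq : q ∈ B.alphaCells ∨ q ∈ B.betaCells)
    (hq' : q ∈ B'.alphaCells ∨ q ∈ B'.betaCells) : B = B' :=
  (h.tiles q).unique ⟨hB, hq⟩ ⟨hB', hq'⟩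

/-- The potential is `α` on closed `α`-cubes, so shared faces must be excluded; for generic points
the half-open cubes decide. -/
theorem potential_eq_beta {n L : ℕ} (hn : 0 < n) {𝓑 : Set (Block d)} (h : IsTiling n L 𝓑)
    {α β : ℝ} {x : Fin d → ℝ} (hx : IsGeneric n x) {B : Block d} (hB : B ∈ 𝓑)
    (hxB : x ∈ betaSet n B) : potential n 𝓑 α β x = β := by
  rw [potential, if_neg]
  rintro ⟨B', hB', hxB'⟩
  have h1 := hx.mem_alphaSet hn hxB'
  have h2 := h.eq_of_mem hB hB' (Or.inr hxB) (Or.inl h1)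
  subst h2
  exact Set.disjoint_left.1 (disjoint_alphaCells_betaCells B) h1 hxB

/-- An interval of `j ≥ ℓ` integers contains a multiple of `ℓ`, and one can be taken close to `y`.
It will label a block by a point of the coarse lattice `ℓℤᵈ`. The slack `2` absorbs the rounding. -/
theorem exists_mul_mem_Ico {ℓ j : ℕ} (hℓ : 0 < ℓ) (hj : ℓ ≤ j) (c : ℤ) {R y : ℝ} (hR : 0 ≤ R)
    (h1 : c - R * ℓ ≤ y) (h2 : y ≤ c + j + R * ℓ) :
    ∃ l : ℤ, (c ≤ ℓ * l ∧ ℓ * l < c + j) ∧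
      ⌊y / ℓ⌋ - (⌈R⌉₊ + 2 : ℕ) ≤ l ∧ l ≤ ⌊y / ℓ⌋ + (⌈R⌉₊ + 2 : ℕ) := by
  have hℓ' : (0 : ℝ) < ℓ := by positivity
  have hℓz : (0 : ℤ) < ℓ := by exact_mod_cast hℓ
  have hjz : (ℓ : ℤ) ≤ j := by exact_mod_cast hj
  set q := ⌊y / ℓ⌋
  have hq1 : (ℓ : ℝ) * q ≤ y := by
    have := Int.floor_le (y / ℓ)
    rw [le_div_iff₀ hℓ'] at this
    linarith
  have hq2 : y < ℓ * (q + 1) := by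
    have := Int.lt_floor_add_one (y / ℓ)
    rw [div_lt_iff₀ hℓ'] at this
    linarith
  have hRc := Nat.le_ceil R
  have bound : ∀ l : ℤ, (ℓ : ℝ) * l < ℓ * (q + (R + 2)) → (ℓ : ℝ) * (q - (R + 2)) ≤ ℓ * l →
      q - (⌈R⌉₊ + 2 : ℕ) ≤ l ∧ l ≤ q + (⌈R⌉₊ + 2 : ℕ) := by
    intro l i1 i2
    have i1' := lt_of_mul_lt_mul_left i1 hℓ'.le
    have i2' := le_of_mul_le_mul_left i2 hℓ'
    have j1 : (l : ℝ) ≤ ((q + (⌈R⌉₊ + 2 : ℕ) : ℤ) : ℝ) := by push_cast; linarith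
    have j2 : ((q - (⌈R⌉₊ + 2 : ℕ) : ℤ) : ℝ) ≤ l := by push_cast; linarith
    exact ⟨by exact_mod_cast j2, by exact_mod_cast j1⟩
  rcases le_or_gt (c + j : ℝ) y with hy | hy
  -- To the right of the interval: its largest multiple of `ℓ`. Otherwise `y` is rounded down, or,
  -- if that falls below `c`, the first multiple from `c` on is taken.
  · refine ⟨(c + j - 1) / ℓ, ⟨?_, ?_⟩, ?_⟩
    · have := Int.emod_lt_of_pos (c + j - 1) hℓz
      have := Int.mul_ediv_add_emod (c + j - 1) ℓ
      omega
    · have := Int.mul_ediv_self_le (x := c + j - 1) hℓz.ne'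
      omega
    · have i1 := Int.mul_ediv_self_le (x := c + j - 1) hℓz.ne'
      have i2 : c + j - ℓ ≤ (ℓ : ℤ) * ((c + j - 1) / ℓ) := by
        have := Int.emod_lt_of_pos (c + j - 1) hℓz
        have := Int.mul_ediv_add_emod (c + j - 1) ℓ
        omega
      have i1' : (ℓ : ℝ) * ((c + j - 1) / ℓ : ℤ) ≤ c + j - 1 := by exact_mod_cast i1
      have i2' : (c : ℝ) + j - ℓ ≤ (ℓ : ℝ) * ((c + j - 1) / ℓ : ℤ) := by exact_mod_cast i2
      refine bound _ ?_ ?_ <;> nlinarith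
  · rcases le_or_gt c (ℓ * q) with hc | hc
    · refine ⟨q, ⟨hc, ?_⟩, bound _ ?_ ?_⟩
      · have : ((ℓ * q : ℤ) : ℝ) < ((c + j : ℤ) : ℝ) := by push_cast; linarith
        exact_mod_cast this
      · nlinarith
      · nlinarith
    · have i1 : c ≤ (ℓ : ℤ) * (-((-c) / ℓ)) := by
        have := Int.mul_ediv_self_le (x := -c) hℓz.ne'
        rw [mul_neg]
        omega
      have i2 : (ℓ : ℤ) * (-((-c) / ℓ)) < c + ℓ := by
        have := Int.emod_lt_of_pos (-c) hℓz
        have := Int.mul_ediv_add_emod (-c) ℓ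
        rw [mul_neg]
        omega
      refine ⟨-((-c) / ℓ), ⟨i1, by omega⟩, bound _ ?_ ?_⟩
      · have i2' : (ℓ : ℝ) * ((-((-c) / ℓ) : ℤ) : ℝ) < c + ℓ := by exact_mod_cast i2
        nlinarith
      · have i1' : (c : ℝ) ≤ (ℓ : ℝ) * ((-((-c) / ℓ) : ℤ) : ℝ) := by exact_mod_cast i1
        have hc' : (ℓ : ℝ) * q < c := by exact_mod_cast hc
        nlinarith

/-- The neighbourhoods of relative size `R` of the large `α`-cubes have bounded overlap. -/
theorem encard_large_le {n L ℓ : ℕ} (hn : 0 < n) (hℓ : 0 < ℓ) {𝓑 : Set (Block d)}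
    (h : IsTiling n L 𝓑) {R : ℝ} (hR : 0 ≤ R) (y : Fin d → ℝ) :
    {B : Block d | B ∈ large ℓ 𝓑 ∧ y ∈ B.alphaCube n (R * (eps n * ℓ))}.encard
      ≤ ((2 * (⌈R⌉₊ + 2) + 1) ^ d : ℕ) := by
  set M := ⌈R⌉₊ + 2
  have hex : ∀ B : Block d, ∃ l : Fin d → ℤ,
      B ∈ large ℓ 𝓑 → y ∈ B.alphaCube n (R * (eps n * ℓ)) →
      (fun k => (ℓ : ℤ) * l k) ∈ B.alphaCells ∧
      l ∈ Fintype.piFinset fun k => Finset.Icc (⌊n * y k / ℓ⌋ - (M : ℤ)) (⌊n * y k / ℓ⌋ + M) := by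
    intro B
    by_cases hB : B ∈ large ℓ 𝓑 ∧ y ∈ B.alphaCube n (R * (eps n * ℓ))
    · have h1 : ∀ k, _ := fun k => exists_mul_mem_Ico hℓ hB.1.2.le (B.corner k) (y := n * y k) hR
        ((eps_mul_le_iff hn _ _).1 (by linarith [(hB.2 k).1]))
        ((le_eps_mul_iff hn _ _).1 (by linarith [(hB.2 k).2]))
      choose l hl1 hl2 using h1
      refine ⟨l, fun _ _ => ⟨hl1, ?_⟩⟩
      rw [Fintype.mem_piFinset]
      exact fun k => Finset.mem_Icc.2 (hl2 k)
    · exact ⟨0, fun h1 h2 => absurd ⟨h1, h2⟩ hB⟩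
  choose l hl using hex
  -- The labels are cells of the `α`-cubes, and a cell belongs to one block only.
  have hinj : Set.InjOn l {B : Block d | B ∈ large ℓ 𝓑 ∧ y ∈ B.alphaCube n (R * (eps n * ℓ))} := by
    intro B hB B' hB' heq
    have h1 := (hl B hB.1 hB.2).1
    have h2 := (hl B' hB'.1 hB'.2).1
    rw [← heq] at h2
    exact h.eq_of_mem hB.1.1 hB'.1.1 (Or.inl h1) (Or.inl h2)
  have hmaps : Set.MapsTo l {B : Block d | B ∈ large ℓ 𝓑 ∧ y ∈ B.alphaCube n (R * (eps n * ℓ))}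
      (Fintype.piFinset fun k => Finset.Icc (⌊n * y k / ℓ⌋ - (M : ℤ)) (⌊n * y k / ℓ⌋ + M) :
        Finset (Fin d → ℤ)) := fun B hB => (hl B hB.1 hB.2).2
  refine (Set.encard_le_encard_of_injOn hmaps hinj).trans ?_
  rw [Set.encard_coe_eq_coe_finsetCard, Fintype.card_piFinset]
  have : ∀ k : Fin d, (Finset.Icc (⌊n * y k / ℓ⌋ - (M : ℤ)) (⌊n * y k / ℓ⌋ + M)).card
      = 2 * M + 1 := by
    intro k
    rw [Int.card_Icc]
    omega
  simp [this]

end Geometry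

/-! ### Energy bounds off the large cubes and for the local errors -/

section Estimates

/-- The energy density as an extended nonnegative real. -/
def energyDensity (V u : (Fin d → ℝ) → ℝ) (g : Fin d → (Fin d → ℝ) → ℝ) (x : Fin d → ℝ) : ℝ≥0∞ :=
  ENNReal.ofReal ((∑ k, g k x ^ 2) + V x * u x ^ 2)

/-- The cube `[-4,4]ᵈ`. -/
def bigBox (d : ℕ) : Set (Fin d → ℝ) := Set.Icc (fun _ => -((4 : ℕ) : ℝ)) fun _ => ((4 : ℕ) : ℝ)

theorem setLIntegral_bigBox_le {f : (Fin d → ℝ) → ℝ≥0∞}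
    (hf : ∀ (m : Fin d → ℤ) x, f (x + intVec m) = f x) :
    ∫⁻ x in bigBox d, f x ≤ 9 ^ d * ∫⁻ x in unitCube d, f x := by
  refine (setLIntegral_box_le hf 4).trans (le_of_eq ?_)
  norm_num

theorem measurableSet_unitCube : MeasurableSet (unitCube d) :=
  MeasurableSet.univ_pi fun _ => measurableSet_Ioo

/-- All shifts in use are at most one block edge or `3h`, and both edges and mesh sizes are at most
one. -/
theorem add_mem_bigBox {x w : Fin d → ℝ} (hx : x ∈ unitCube d) (hw : ∀ k, |w k| ≤ 3) :
    x + w ∈ bigBox d := by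
  have h : ∀ k, -((4 : ℕ) : ℝ) ≤ x k + w k ∧ x k + w k ≤ ((4 : ℕ) : ℝ) := by
    intro k
    have h1 := hx k (Set.mem_univ k)
    have h2 := abs_le.1 (hw k)
    push_cast
    constructor <;> linarith [h1.1, h1.2]
  exact ⟨fun k => (h k).1, fun k => (h k).2⟩

theorem unitCube_subset_bigBox : unitCube d ⊆ bigBox d := fun x hx => by
  simpa using add_mem_bigBox (w := 0) hx (by simp)

theorem potential_add_intVec {n L : ℕ} (hn : 0 < n) {𝓑 : Set (Block d)} (h : IsTiling n L 𝓑)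
    (α β : ℝ) (m : Fin d → ℤ) (x : Fin d → ℝ) :
    potential n 𝓑 α β (x + intVec m) = potential n 𝓑 α β x := by
  have key : ∀ (m : Fin d → ℤ) (x : Fin d → ℝ), (∃ B ∈ 𝓑, x ∈ B.alphaCube n 0) →
      ∃ B ∈ 𝓑, x + intVec m ∈ B.alphaCube n 0 := by
    rintro m x ⟨B, hB, hx⟩
    exact ⟨_, h.shift_mem B hB m, mem_alphaCube_shift hn m hx⟩
  have hiff : (∃ B ∈ 𝓑, x + intVec m ∈ B.alphaCube n 0) ↔ ∃ B ∈ 𝓑, x ∈ B.alphaCube n 0 := by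
    refine ⟨fun hx => ?_, key m x⟩
    have := key (-m) _ hx
    have e : x + intVec m + intVec (-m) = x := by
      funext k
      simp [intVec]
    rwa [e] at this
  by_cases hx : ∃ B ∈ 𝓑, x ∈ B.alphaCube n 0
  · rw [potential, potential, if_pos hx, if_pos (hiff.2 hx)]
  · rw [potential, potential, if_neg hx, if_neg fun hx' => hx (hiff.1 hx')]

theorem measurable_potential (n : ℕ) (𝓑 : Set (Block d)) (α β : ℝ) :
    Measurable (potential n 𝓑 α β) := by
  classical
  have hs : MeasurableSet {x : Fin d → ℝ | ∃ B ∈ 𝓑, x ∈ B.alphaCube n 0} := by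
    have : {x : Fin d → ℝ | ∃ B ∈ 𝓑, x ∈ B.alphaCube n 0} = ⋃ B ∈ 𝓑, B.alphaCube n 0 := by
      ext x
      simp
    rw [this]
    exact MeasurableSet.biUnion (Set.to_countable _)
      fun B _ => (isClosed_alphaCube n 0 B).measurableSet
  have : potential n 𝓑 α β = Set.piecewise {x : Fin d → ℝ | ∃ B ∈ 𝓑, x ∈ B.alphaCube n 0}
      (fun _ => α) fun _ => β := by
    ext x
    by_cases hx : ∃ B ∈ 𝓑, x ∈ B.alphaCube n 0 <;> simp [potential, Set.piecewise, hx]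
  rw [this]
  exact Measurable.piecewise hs measurable_const measurable_const

theorem potential_nonneg (n : ℕ) (𝓑 : Set (Block d)) {α β : ℝ} (hα : 0 ≤ α) (hαβ : α ≤ β)
    (x : Fin d → ℝ) : 0 ≤ potential n 𝓑 α β x := by
  rw [potential]
  split_ifs
  exacts [hα, hα.trans hαβ]

theorem potential_le (n : ℕ) (𝓑 : Set (Block d)) {α β : ℝ} (hαβ : α ≤ β)
    (x : Fin d → ℝ) : potential n 𝓑 α β x ≤ β := by
  rw [potential]
  split_ifs
  exacts [hαβ, le_rfl]

theorem measurable_energyDensity {V u : (Fin d → ℝ) → ℝ} {g : Fin d → (Fin d → ℝ) → ℝ}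
    (hV : Measurable V) (hu : Measurable u) (hg : ∀ k, Measurable (g k)) :
    Measurable (energyDensity V u g) := by
  unfold energyDensity
  fun_prop

theorem gsq_le_energyDensity {V u : (Fin d → ℝ) → ℝ} {g : Fin d → (Fin d → ℝ) → ℝ}
    {x : Fin d → ℝ} (hV : 0 ≤ V x) : gsq g x ≤ energyDensity V u g x :=
  ENNReal.ofReal_le_ofReal (le_add_of_nonneg_right (mul_nonneg hV (sq_nonneg _)))

theorem eps_mul_size_le_one {n L : ℕ} (hn : 0 < n) {𝓑 : Set (Block d)} (h : IsTiling n L 𝓑)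
    {B : Block d} (hB : B ∈ 𝓑) : eps n * B.size ≤ 1 := by
  have h1 : (B.size : ℝ) ≤ n := by exact_mod_cast h.size_le hn hB
  have h2 : (0 : ℝ) < n := by positivity
  rw [eps, one_div, inv_mul_le_iff₀ h2]
  linarith

theorem sum_translation_sq (n : ℕ) (B : Block d) :
    ∑ k, B.translation n k ^ 2 = (eps n * B.size) ^ 2 := by
  rw [Finset.sum_eq_single B.axis]
  · by_cases h : B.up <;> simp [Block.translation, h]
  · intro k _ hk
    simp [Block.translation, hk]
  · simp

theorem abs_translation_le {n : ℕ} (hn : 0 < n) (B : Block d) (k : Fin d) :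
    |B.translation n k| ≤ eps n * B.size := by
  have he := eps_pos hn
  have : 0 ≤ eps n * B.size := by positivity
  by_cases hk : k = B.axis
  · subst hk
    by_cases h : B.up <;> simp [Block.translation, h, abs_of_nonneg, this]
  · simp [Block.translation, hk, this]

/-- Friedrichs' inequality on the `α`-cube of a block. -/
theorem lintegral_alphaSet_le {n L : ℕ} (hn : 0 < n) {𝓑 : Set (Block d)} (h : IsTiling n L 𝓑)
    {B : Block d} (hB : B ∈ 𝓑) {u : (Fin d → ℝ) → ℝ} {g : Fin d → (Fin d → ℝ) → ℝ}
    (hu : IsH1Per u g) (hum : Measurable u) (hgm : ∀ k, Measurable (g k)) :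
    ∫⁻ x in unitCube d ∩ alphaSet n B, esq (u x) ≤
      2 * (∫⁻ x in bigBox d ∩ betaSet n B, esq (u x)) +
      2 * (ENNReal.ofReal ((eps n * B.size) ^ 2) *
        ∫⁻ x in bigBox d ∩ (alphaSet n B ∪ betaSet n B), gsq g x) := by
  set w := B.translation n
  have hsz := eps_mul_size_le_one hn h hB
  have hbox : ∀ x ∈ unitCube d, ∀ s ∈ Set.Icc (0 : ℝ) 1, x + s • w ∈ bigBox d := by
    intro x hx s hs
    refine add_mem_bigBox hx fun k => ?_
    have h1 := abs_translation_le hn B k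
    rw [Pi.smul_apply, smul_eq_mul, abs_mul, abs_of_nonneg hs.1]
    have h2 := mul_le_of_le_one_left (abs_nonneg (w k)) hs.2
    linarith
  calc ∫⁻ x in unitCube d ∩ alphaSet n B, esq (u x)
      ≤ ∫⁻ x in unitCube d ∩ alphaSet n B,
          (2 * esq (u (x + w)) + 2 * esq (u (x + w) - u x)) := by
        refine lintegral_mono fun x => ?_
        have := esq_add_le (u (x + w)) (-(u (x + w) - u x))
        rw [esq_neg] at this
        simpa using this
    _ = 2 * (∫⁻ x in unitCube d ∩ alphaSet n B, esq (u (x + w))) +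
          2 * ∫⁻ x in unitCube d ∩ alphaSet n B, esq (u (x + w) - u x) := by
        rw [lintegral_add_left (by fun_prop), lintegral_const_mul' _ _ (by simp),
          lintegral_const_mul' _ _ (by simp)]
    _ ≤ _ := by
        refine add_le_add (mul_le_mul_right ?_ _) (mul_le_mul_right ?_ _)
        · refine setLIntegral_comp_add_le (f := fun x => esq (u x)) w fun x hx => ⟨?_, add_translation_mem hn hx.2⟩
          simpa using hbox x hx.1 1 (by simp)
        · rw [← sum_translation_sq]
          refine lintegral_esq_translate_sub_le hu hum hgm w fun x hx s hs => ?_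
          exact ⟨hbox x hx.1 s ⟨hs.1.le, hs.2⟩, add_smul_translation_mem hn hx.2 ⟨hs.1.le, hs.2⟩⟩

/-- On `β`-cubes `V = β`, and the lower bound on `β` reads `1 ≤ (ε²/c_β) V`. -/
theorem ae_esq_le_of_mem_betaSet {n L : ℕ} (hn : 0 < n) {𝓑 : Set (Block d)} (h : IsTiling n L 𝓑)
    {α β cβ : ℝ} (hcβ : 0 < cβ) (hβ : cβ * (eps n ^ 2)⁻¹ ≤ β) (u : (Fin d → ℝ) → ℝ)
    (g : Fin d → (Fin d → ℝ) → ℝ) :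
    ∀ᵐ x, ∀ B ∈ 𝓑, x ∈ betaSet n B →
      esq (u x) ≤ ENNReal.ofReal (eps n ^ 2 / cβ) * energyDensity (potential n 𝓑 α β) u g x := by
  have he := eps_pos hn
  filter_upwards [ae_isGeneric hn] with x hx B hB hxB
  rw [energyDensity, potential_eq_beta hn h hx hB hxB, ← ENNReal.ofReal_mul (by positivity)]
  refine ENNReal.ofReal_le_ofReal ?_
  have h1 : 1 ≤ eps n ^ 2 / cβ * β := by
    calc (1 : ℝ) = eps n ^ 2 / cβ * (cβ * (eps n ^ 2)⁻¹) := by field_simp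
      _ ≤ _ := by gcongr
  calc u x ^ 2 ≤ (eps n ^ 2 / cβ * β) * u x ^ 2 := le_mul_of_one_le_left (sq_nonneg _) h1
    _ = eps n ^ 2 / cβ * (β * u x ^ 2) := by ring
    _ ≤ _ := by
      gcongr
      exact le_add_of_nonneg_left (Finset.sum_nonneg fun _ _ => sq_nonneg _)

/-- The sum of the indicators of the `T i` is at most `K`; Tonelli does the rest. -/
theorem tsum_setLIntegral_le {ι : Type*} [Countable ι] {T : ι → Set (Fin d → ℝ)}
    {S : Set (Fin d → ℝ)} (hT : ∀ i, MeasurableSet (T i)) (hS : ∀ i, T i ⊆ S) {K : ℕ}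
    (hK : ∀ y, {i | y ∈ T i}.encard ≤ K) {f : (Fin d → ℝ) → ℝ≥0∞} (hf : Measurable f) :
    ∑' i, ∫⁻ x in T i, f x ≤ K * ∫⁻ x in S, f x := by
  have h1 : ∀ i, ∫⁻ x in T i, f x = ∫⁻ x in S, (T i).indicator f x := by
    intro i
    rw [lintegral_indicator (hT i), Measure.restrict_restrict (hT i),
      Set.inter_eq_left.2 (hS i)]
  simp_rw [h1]
  rw [← lintegral_tsum fun i => (hf.indicator (hT i)).aemeasurable,
    ← lintegral_const_mul' _ _ (by simp)]
  refine lintegral_mono fun y => ?_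
  have h2 : ∀ i, (T i).indicator f y = {i | y ∈ T i}.indicator (fun _ => f y) i := by
    intro i
    by_cases hi : y ∈ T i <;> simp [hi]
  simp_rw [h2]
  rw [← tsum_subtype, ENNReal.tsum_set_const]
  refine mul_le_mul_left ?_ _
  exact_mod_cast hK y

/-- The `L²` norm on the complement of the large `α`-cubes is controlled by the energy. -/
theorem lintegral_compl_largeAlpha_le {n L ℓ : ℕ} (hn : 0 < n) (hℓ : 0 < ℓ) {𝓑 : Set (Block d)}
    (h : IsTiling n L 𝓑) {α β cβ : ℝ} (hα : 0 ≤ α) (hαβ : α ≤ β) (hcβ : 0 < cβ)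
    (hβ : cβ * (eps n ^ 2)⁻¹ ≤ β) {u : (Fin d → ℝ) → ℝ} {g : Fin d → (Fin d → ℝ) → ℝ}
    (hu : IsH1Per u g) (hum : Measurable u) (hgm : ∀ k, Measurable (g k)) :
    ∫⁻ x in unitCube d \ largeAlpha n ℓ 𝓑, esq (u x) ≤
      ENNReal.ofReal ((3 / cβ + 2) * (eps n * ℓ) ^ 2) *
        (9 ^ d * ∫⁻ x in unitCube d, energyDensity (potential n 𝓑 α β) u g x) := by
  have he := eps_pos hn
  set en := energyDensity (potential n 𝓑 α β) u g with hen
  have henm : Measurable en := measurable_energyDensity (measurable_potential _ _ _ _) hum hgm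
  have hper : ∀ (m : Fin d → ℤ) x, en (x + intVec m) = en x := by
    intro m x
    simp only [hen, energyDensity, hu.periodic, hu.periodic_grad, potential_add_intVec hn h]
  set H : Block d → Set (Fin d → ℝ) := fun B => bigBox d ∩ (alphaSet n B ∪ betaSet n B)
  have hHm : ∀ B, MeasurableSet (H B) := fun B => measurableSet_Icc.inter
    ((measurableSet_alphaSet n B).union (measurableSet_betaSet n B))
  have hℓ1 : (1 : ℝ) ≤ ℓ := by exact_mod_cast hℓ
  have hbeta : ∀ B ∈ 𝓑, ∀ S ⊆ bigBox d, MeasurableSet S → ∫⁻ x in S ∩ betaSet n B, esq (u x) ≤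
      ENNReal.ofReal ((eps n * ℓ) ^ 2 / cβ) * ∫⁻ x in H B, en x := by
    intro B hB S hS hSm
    calc _ ≤ ∫⁻ x in S ∩ betaSet n B, ENNReal.ofReal ((eps n * ℓ) ^ 2 / cβ) * en x := by
          refine setLIntegral_mono_ae' (hSm.inter (measurableSet_betaSet n B)) ?_
          filter_upwards [ae_esq_le_of_mem_betaSet hn h hcβ hβ u g] with x hx hxB
          refine (hx B hB hxB.2).trans (mul_le_mul_left (ENNReal.ofReal_le_ofReal ?_) _)
          gcongr
          exact le_mul_of_one_le_right he.le hℓ1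
      _ = ENNReal.ofReal ((eps n * ℓ) ^ 2 / cβ) * ∫⁻ x in S ∩ betaSet n B, en x :=
          lintegral_const_mul' _ _ (by simp)
      _ ≤ _ := mul_le_mul_right (lintegral_mono_set
          (Set.inter_subset_inter hS Set.subset_union_right)) _
  -- The second set is empty for large blocks. The `3` is `1` from the `β`-cube itself plus `2` from
  -- Friedrichs' inequality on the `α`-cube.
  have hblock : ∀ B ∈ 𝓑, ∫⁻ x in (unitCube d ∩ betaSet n B) ∪
      {x ∈ unitCube d ∩ alphaSet n B | B.size ≤ ℓ}, esq (u x) ≤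
      ENNReal.ofReal ((3 / cβ + 2) * (eps n * ℓ) ^ 2) * ∫⁻ x in H B, en x := by
    intro B hB
    have h1 := hbeta B hB _ unitCube_subset_bigBox measurableSet_unitCube
    have h2 := hbeta B hB _ subset_rfl measurableSet_Icc
    have h3 : ∫⁻ x in {x ∈ unitCube d ∩ alphaSet n B | B.size ≤ ℓ}, esq (u x) ≤
        2 * (ENNReal.ofReal ((eps n * ℓ) ^ 2 / cβ) * ∫⁻ x in H B, en x) +
        2 * (ENNReal.ofReal ((eps n * ℓ) ^ 2) * ∫⁻ x in H B, en x) := by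
      by_cases hs : B.size ≤ ℓ
      · simp only [hs, and_true, Set.ofPred_mem_eq]
        have hs' : (B.size : ℝ) ≤ ℓ := by exact_mod_cast hs
        have i1 : (eps n * B.size) ^ 2 ≤ (eps n * ℓ) ^ 2 := by gcongr
        have i2 : ∫⁻ x in H B, gsq g x ≤ ∫⁻ x in H B, en x :=
          lintegral_mono fun x => gsq_le_energyDensity (potential_nonneg _ _ hα hαβ x)
        have i3 := mul_le_mul' (ENNReal.ofReal_le_ofReal i1) i2
        exact (lintegral_alphaSet_le hn h hB hu hum hgm).trans
          (add_le_add (mul_le_mul_right h2 2) (mul_le_mul_right i3 2))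
      · simp [hs]
    have e1 : ENNReal.ofReal ((3 / cβ + 2) * (eps n * ℓ) ^ 2) =
        3 * ENNReal.ofReal ((eps n * ℓ) ^ 2 / cβ) + 2 * ENNReal.ofReal ((eps n * ℓ) ^ 2) := by
      have : (3 / cβ + 2) * (eps n * ℓ) ^ 2
          = 3 * ((eps n * ℓ) ^ 2 / cβ) + 2 * (eps n * ℓ) ^ 2 := by ring
      rw [this, ENNReal.ofReal_add (by positivity) (by positivity),
        ENNReal.ofReal_mul (by norm_num), ENNReal.ofReal_mul (by norm_num)]
      simp
    rw [e1]
    calc _ ≤ _ := lintegral_union_le _ _ _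
      _ ≤ _ := add_le_add h1 h3
      _ = _ := by ring
  have hcover : unitCube d \ largeAlpha n ℓ 𝓑 ⊆ ⋃ B : 𝓑, (unitCube d ∩ betaSet n B.1) ∪
      {x ∈ unitCube d ∩ alphaSet n B.1 | B.1.size ≤ ℓ} := by
    intro x hx
    obtain ⟨B, ⟨hB, hq⟩, -⟩ := h.tiles (cellIndex n x)
    simp only [Set.mem_iUnion, Set.mem_union, Set.mem_inter_iff]
    refine ⟨⟨B, hB⟩, ?_⟩
    rcases hq with hq | hq
    · refine Or.inr ⟨⟨hx.1, hq⟩, ?_⟩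
      by_contra hlt
      exact hx.2 ⟨B, ⟨hB, not_le.1 hlt⟩, alphaSet_subset_alphaCube hn B hq⟩
    · exact Or.inl ⟨hx.1, hq⟩
  -- Half-open blocks are disjoint, so the overlap number is one.
  have hone : ∀ y, {B : 𝓑 | y ∈ H B.1}.encard ≤ (1 : ℕ) := by
    intro y
    rw [Nat.cast_one, Set.encard_le_one_iff]
    intro B B' hB hB'
    exact Subtype.ext (h.eq_of_mem B.2 B'.2 hB.2 hB'.2)
  have hfin : ∑' B : 𝓑, ∫⁻ x in H B.1, en x ≤ 9 ^ d * ∫⁻ x in unitCube d, en x := by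
    have h1 := tsum_setLIntegral_le (T := fun B : 𝓑 => H B.1) (fun B => hHm B.1)
      (fun B => Set.inter_subset_left) hone henm
    rw [Nat.cast_one, one_mul] at h1
    exact h1.trans (setLIntegral_bigBox_le hper)
  calc _ ≤ ∑' B : 𝓑, ∫⁻ x in (unitCube d ∩ betaSet n B.1) ∪
          {x ∈ unitCube d ∩ alphaSet n B.1 | B.1.size ≤ ℓ}, esq (u x) :=
        (lintegral_mono_set hcover).trans (lintegral_iUnion_le _ _)
    _ ≤ ∑' B : 𝓑, ENNReal.ofReal ((3 / cβ + 2) * (eps n * ℓ) ^ 2) * ∫⁻ x in H B.1, en x :=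
        ENNReal.tsum_le_tsum fun B => hblock B.1 B.2
    _ = ENNReal.ofReal ((3 / cβ + 2) * (eps n * ℓ) ^ 2) * ∑' B : 𝓑, ∫⁻ x in H B.1, en x :=
        ENNReal.tsum_mul_left
    _ ≤ _ := mul_le_mul_right hfin _

/-- The local contribution of a large block to the interpolation error. -/
def localError (n : ℕ) (N : Block d → ℕ) (u : (Fin d → ℝ) → ℝ) (g : Fin d → (Fin d → ℝ) → ℝ)
    (B : Block d) (x : Fin d → ℝ) : ℝ≥0∞ :=
  2 * 16 ^ d * ((ENNReal.ofReal (meshSize n N B ^ d))⁻¹ *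
    ∫⁻ w in Set.Icc (fun _ => -(3 * meshSize n N B)) (fun _ => 3 * meshSize n N B),
      (esq (u (x + w) - u x) + ENNReal.ofReal (meshSize n N B ^ 2) * gsq g (x + w)))

theorem measurable_localError (n : ℕ) (N : Block d → ℕ) {u : (Fin d → ℝ) → ℝ}
    {g : Fin d → (Fin d → ℝ) → ℝ} (hum : Measurable u) (hgm : ∀ k, Measurable (g k))
    (B : Block d) : Measurable (localError n N u g B) := by
  have hG := measurable_gsq hgm
  unfold localError
  refine Measurable.const_mul (Measurable.const_mul ?_ _) _
  refine Measurable.lintegral_prod_right' (f := fun p : (Fin d → ℝ) × (Fin d → ℝ) =>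
    esq (u (p.1 + p.2) - u p.1) + ENNReal.ofReal (meshSize n N B ^ 2) * gsq g (p.1 + p.2)) ?_
  fun_prop

/-- By Tonelli the translation estimate is applied for each fixed `w`, with `|w|² ≤ 9 d h²`. The
volume `(6h)^d` of the cube of shifts cancels the factor `h^{-d}`. -/
theorem setLIntegral_localError_le {n : ℕ} {N : Block d → ℕ} {u : (Fin d → ℝ) → ℝ}
    {g : Fin d → (Fin d → ℝ) → ℝ} (hu : IsH1Per u g) (hum : Measurable u)
    (hgm : ∀ k, Measurable (g k)) {B : Block d} (hh : 0 < meshSize n N B)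
    {A T : Set (Fin d → ℝ)}
    (hT : ∀ x ∈ A, ∀ w : Fin d → ℝ, (∀ k, |w k| ≤ 3 * meshSize n N B) → x + w ∈ T) :
    ∫⁻ x in A, localError n N u g B x ≤
      2 * 16 ^ d * (6 ^ d * (ENNReal.ofReal ((9 * d + 1) * meshSize n N B ^ 2) *
        ∫⁻ x in T, gsq g x)) := by
  have hG := measurable_gsq hgm
  set h := meshSize n N B with hh'
  set I : Set (Fin d → ℝ) := Set.Icc (fun _ => -(3 * h)) (fun _ => 3 * h) with hI
  have hw : ∀ w ∈ I, ∀ k, |w k| ≤ 3 * h := fun w hw k => abs_le.2 ⟨hw.1 k, hw.2 k⟩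
  have hc : ENNReal.ofReal (h ^ d) ≠ 0 := by
    rw [Ne, ENNReal.ofReal_eq_zero, not_le]
    positivity
  have hvol : volume I = 6 ^ d * ENNReal.ofReal (h ^ d) := by
    rw [hI, Real.volume_Icc_pi]
    have : 3 * h - -(3 * h) = 6 * h := by ring
    simp only [this, Finset.prod_const, Finset.card_univ, Fintype.card_fin]
    rw [ENNReal.ofReal_mul (by norm_num), mul_pow, ENNReal.ofReal_pow hh.le]
    norm_num
  have inner : ∀ w ∈ I, ∫⁻ x in A, (esq (u (x + w) - u x) +
      ENNReal.ofReal (h ^ 2) * gsq g (x + w)) ≤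
      ENNReal.ofReal ((9 * d + 1) * h ^ 2) * ∫⁻ x in T, gsq g x := by
    intro w hwI
    rw [lintegral_add_left (by fun_prop), lintegral_const_mul' _ _ (by simp)]
    have h1 := lintegral_esq_translate_sub_le hu hum hgm (A := A) (T := T) w
      fun x hx s hs => hT x hx _ fun k => by
        rw [Pi.smul_apply, smul_eq_mul, abs_mul, abs_of_nonneg hs.1.le]
        exact (mul_le_of_le_one_left (abs_nonneg _) hs.2).trans (hw w hwI k)
    have h2 := setLIntegral_comp_add_le (f := gsq g) (A := A) (T := T) w
      fun x hx => hT x hx _ (hw w hwI)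
    have h3 : ∑ k, w k ^ 2 ≤ 9 * d * h ^ 2 := by
      calc ∑ k, w k ^ 2 ≤ ∑ _k : Fin d, 9 * h ^ 2 := by
            refine Finset.sum_le_sum fun k _ => ?_
            have := sq_le_sq' (abs_le.1 (hw w hwI k)).1 (abs_le.1 (hw w hwI k)).2
            nlinarith
        _ = 9 * d * h ^ 2 := by simp; ring
    calc _ ≤ ENNReal.ofReal (9 * d * h ^ 2) * (∫⁻ x in T, gsq g x) +
          ENNReal.ofReal (h ^ 2) * ∫⁻ x in T, gsq g x :=
          add_le_add (h1.trans (mul_le_mul_left (ENNReal.ofReal_le_ofReal h3) _))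
            (mul_le_mul_right h2 _)
      _ = _ := by
          rw [← add_mul, ← ENNReal.ofReal_add (by positivity) (by positivity)]
          congr 2
          ring
  have hswap : ∫⁻ x in A, ∫⁻ w in I, (esq (u (x + w) - u x) +
      ENNReal.ofReal (h ^ 2) * gsq g (x + w)) ≤
      ENNReal.ofReal ((9 * d + 1) * h ^ 2) * (∫⁻ x in T, gsq g x) * volume I := by
    rw [lintegral_lintegral_swap (by fun_prop)]
    refine (setLIntegral_mono' measurableSet_Icc inner).trans (le_of_eq ?_)
    rw [setLIntegral_const]
  unfold localError
  rw [lintegral_const_mul' _ _ (by finiteness), lintegral_const_mul' _ _ (ENNReal.inv_ne_top.2 hc)]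
  refine mul_le_mul_right ((mul_le_mul_right hswap _).trans (le_of_eq ?_)) _
  rw [hvol]
  set X := ENNReal.ofReal ((9 * d + 1) * h ^ 2) * ∫⁻ x in T, gsq g x
  calc (ENNReal.ofReal (h ^ d))⁻¹ * (X * (6 ^ d * ENNReal.ofReal (h ^ d)))
      = ((ENNReal.ofReal (h ^ d))⁻¹ * ENNReal.ofReal (h ^ d)) * (6 ^ d * X) := by ring
    _ = _ := by rw [ENNReal.inv_mul_cancel hc ENNReal.ofReal_ne_top, one_mul]

end Estimates

/-! ### Measurability of the extended finite element function -/

section Measurability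

/-- The interpolated values form an arbitrary function on grid points; countability of the grid
makes its regularity irrelevant. -/
theorem measurable_comp_of_countable_range {α β γ : Type*} [MeasurableSpace α] [MeasurableSpace β]
    [MeasurableSpace γ] [MeasurableSingletonClass β] {q : α → β} (hq : Measurable q)
    (hc : (Set.range q).Countable) (f : β → γ) : Measurable fun x => f (q x) := by
  intro A _
  have : (fun x => f (q x)) ⁻¹' A = q ⁻¹' (f ⁻¹' A ∩ Set.range q) := by
    ext x
    simp
  rw [this]
  exact hq (hc.mono Set.inter_subset_right).measurableSet

theorem measurable_gridRem (a h : ℝ) : Measurable (gridRem a h) := by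
  unfold gridRem
  have : Measurable fun y : ℝ => ((⌊(y - a) / h⌋ : ℤ) : ℝ) :=
    measurable_from_top.comp (Int.measurable_floor.comp (by fun_prop))
  fun_prop

theorem measurable_subLo (δ h : ℝ) : Measurable (subLo δ h) := by
  unfold subLo
  exact Measurable.ite measurableSet_Iio measurable_const
    (Measurable.ite measurableSet_Iio measurable_const measurable_const)

theorem measurable_subHi (δ h : ℝ) : Measurable (subHi δ h) := by
  unfold subHi
  exact Measurable.ite measurableSet_Iio measurable_const
    (Measurable.ite measurableSet_Iio measurable_const measurable_const)

theorem measurable_fineInterp (n : ℕ) (N : Block d → ℕ) (B : Block d) (f : (Fin d → ℝ) → ℝ) :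
    Measurable (fineInterp n N B f) := by
  have hr : ∀ k, Measurable fun x : Fin d → ℝ =>
      gridRem (eps n * B.corner k) (meshSize n N B) (x k) := fun k =>
    (measurable_gridRem _ _).comp (measurable_pi_apply k)
  have hlo : ∀ k, Measurable fun x : Fin d → ℝ => subLo (eps n / 2) (meshSize n N B)
      (gridRem (eps n * B.corner k) (meshSize n N B) (x k)) := fun k =>
    (measurable_subLo _ _).comp (hr k)
  have hhi : ∀ k, Measurable fun x : Fin d → ℝ => subHi (eps n / 2) (meshSize n N B)
      (gridRem (eps n * B.corner k) (meshSize n N B) (x k)) := fun k =>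
    (measurable_subHi _ _).comp (hr k)
  unfold fineInterp
  refine Finset.measurable_sum _ fun s _ => Measurable.mul (Finset.measurable_prod _ fun k _ => ?_) ?_
  · have := hr k
    have := hlo k
    have := hhi k
    by_cases hs : s k <;> simp only [hs, if_true, if_false, Bool.false_eq_true] <;> fun_prop
  · refine measurable_comp_of_countable_range (measurable_pi_lambda _ fun k => ?_) ?_ f
    · have := hr k
      have := hlo k
      have := hhi k
      by_cases hs : s k <;> simp only [hs, if_true, if_false, Bool.false_eq_true] <;> fun_prop
    · refine Set.Countable.mono ?_ (Set.countable_univ_pi fun k => Set.Countable.image2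
        (Set.to_countable (Set.univ : Set ℤ)) (Set.to_countable ({0, eps n / 2,
          meshSize n N B - eps n / 2, meshSize n N B} : Set ℝ))
        fun z v => eps n * B.corner k + meshSize n N B * z + v)
      rintro _ ⟨x, rfl⟩ k _
      refine ⟨⌊(x k - eps n * B.corner k) / meshSize n N B⌋, Set.mem_univ _,
        if s k then subHi (eps n / 2) (meshSize n N B)
          (gridRem (eps n * B.corner k) (meshSize n N B) (x k)) else subLo (eps n / 2)
          (meshSize n N B) (gridRem (eps n * B.corner k) (meshSize n N B) (x k)), ?_, ?_⟩
      · unfold subHi subLo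
        split_ifs <;> simp
      · simp only [gridRem]
        ring

theorem gridRem_eq {a a' h : ℝ} (hh : h ≠ 0) {z : ℤ} (hz : a - a' = z * h) (y : ℝ) :
    gridRem a h y = gridRem a' h y := by
  have h1 : (y - a) / h = (y - a') / h - z := by
    field_simp
    linarith
  rw [gridRem, gridRem, h1, Int.floor_sub_intCast]
  push_cast
  linear_combination -hz

/-- Meshes of touching cubes differ by a multiple of `h`, which the remainder modulo `h` does not
see. The interpolation is thus independent of the block chosen. -/
theorem fineInterp_eq {n ℓ : ℕ} (hn : 0 < n) {𝓑 : Set (Block d)} {cm : ℝ} {N : Block d → ℕ}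
    (hN : IsMesh n ℓ 𝓑 cm N) {B B' : Block d} (hB : B ∈ large ℓ 𝓑) (hB' : B' ∈ large ℓ 𝓑)
    (hne : (B.alphaCube n 0 ∩ B'.alphaCube n 0).Nonempty) (f : (Fin d → ℝ) → ℝ) (x : Fin d → ℝ) :
    fineInterp n N B f x = fineInterp n N B' f x := by
  obtain ⟨h1, h2⟩ := hN.conform B hB B' hB' hne
  have hpos : meshSize n N B ≠ 0 := ((eps_pos hn).trans_le (hN.le_meshSize B hB)).ne'
  have h3 : ∀ k, gridRem (eps n * B.corner k) (meshSize n N B') (x k)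
      = gridRem (eps n * B'.corner k) (meshSize n N B') (x k) := by
    intro k
    obtain ⟨z, hz⟩ := h2 k
    rw [← h1]
    exact gridRem_eq hpos hz _
  simp only [fineInterp, h3, h1]

theorem aemeasurable_of_countable_cover {ι : Type*} [Countable ι] {f : (Fin d → ℝ) → ℝ}
    (s : ι → Set (Fin d → ℝ)) (hs : ∀ i, MeasurableSet (s i)) (g : ι → (Fin d → ℝ) → ℝ)
    (hg : ∀ i, Measurable (g i)) (h : ∀ᵐ x, (∃ i, x ∈ s i) ∧ ∀ i, x ∈ s i → f x = g i x) :
    AEMeasurable f volume := by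
  have h1 : (⋃ i, s i) =ᵐ[volume] Set.univ := by
    rw [Filter.eventuallyEq_univ]
    filter_upwards [h] with x hx
    exact Set.mem_iUnion.2 hx.1
  have h2 : AEMeasurable f (volume.restrict (⋃ i, s i)) := by
    rw [aemeasurable_iUnion_iff]
    intro i
    refine (hg i).aemeasurable.congr ?_
    rw [Filter.EventuallyEq, ae_restrict_iff' (hs i)]
    filter_upwards [h] with x hx hxs
    exact (hx.2 i hxs).symm
  rwa [Measure.restrict_congr_set h1, Measure.restrict_univ] at h2

/-- The extension is defined through chosen blocks, but at generic points the choice is immaterial: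
`α`-cubes do not overlap, and overlapping layers belong to touching cubes. On countably many
measurable pieces it therefore equals an explicit formula. -/
theorem aemeasurable_extend {n L ℓ : ℕ} (hn : 0 < n) {𝓑 : Set (Block d)} (h : IsTiling n L 𝓑)
    {cm : ℝ} {N : Block d → ℕ} (hN : IsMesh n ℓ 𝓑 cm N) (c : (Fin d → ℝ) → ℝ) :
    AEMeasurable (extend n ℓ 𝓑 N c) volume := by
  have hcube : ∀ r, MeasurableSet {x : Fin d → ℝ | ∃ B ∈ large ℓ 𝓑, x ∈ B.alphaCube n r} := by
    intro r
    have : {x : Fin d → ℝ | ∃ B ∈ large ℓ 𝓑, x ∈ B.alphaCube n r}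
        = ⋃ B ∈ large ℓ 𝓑, B.alphaCube n r := by
      ext x
      simp
    rw [this]
    exact MeasurableSet.biUnion (Set.to_countable _)
      fun B _ => (isClosed_alphaCube n r B).measurableSet
  have hlarge : MeasurableSet (largeAlpha n ℓ 𝓑) := hcube 0
  refine aemeasurable_of_countable_cover (ι := large ℓ 𝓑 ⊕ large ℓ 𝓑 ⊕ Unit)
    (Sum.elim (fun B => B.1.alphaCube n 0) (Sum.elim
      (fun B => B.1.alphaCube n (eps n / 2) \ largeAlpha n ℓ 𝓑)
      fun _ => (largeAlpha n ℓ 𝓑 ∪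
        {x : Fin d → ℝ | ∃ B ∈ large ℓ 𝓑, x ∈ B.alphaCube n (eps n / 2)})ᶜ)) ?_
    (Sum.elim (fun B => q1Block n N c B.1) (Sum.elim
      (fun B => fineInterp n N B.1 (q1Large n ℓ 𝓑 N c)) fun _ _ => 0)) ?_ ?_
  · rintro (B | B | _)
    · exact (isClosed_alphaCube n 0 B.1).measurableSet
    · exact (isClosed_alphaCube n _ B.1).measurableSet.diff hlarge
    · exact (hlarge.union (hcube _)).compl
  · rintro (B | B | _)
    · simp only [Sum.elim_inl]
      unfold q1Block hat
      fun_prop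
    · exact measurable_fineInterp n N B.1 _
    · exact measurable_const
  · filter_upwards [ae_isGeneric hn] with x hx
    constructor
    · by_cases h1 : x ∈ largeAlpha n ℓ 𝓑
      · obtain ⟨B, hB, hxB⟩ := h1
        exact ⟨Sum.inl ⟨B, hB⟩, hxB⟩
      · by_cases h2 : ∃ B ∈ large ℓ 𝓑, x ∈ B.alphaCube n (eps n / 2)
        · obtain ⟨B, hB, hxB⟩ := h2
          exact ⟨Sum.inr (Sum.inl ⟨B, hB⟩), hxB, h1⟩
        · exact ⟨Sum.inr (Sum.inr ()), fun h3 => h3.elim h1 h2⟩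
    · rintro (⟨B, hB⟩ | ⟨B, hB⟩ | _) hxs
      · have hx1 : ∃ B ∈ large ℓ 𝓑, x ∈ B.alphaCube n 0 := ⟨B, hB, hxs⟩
        have hx2 : x ∈ largeAlpha n ℓ 𝓑 := hx1
        rw [extend, if_pos hx2, q1Large, dif_pos hx1]
        have h3 := h.eq_of_mem hx1.choose_spec.1.1 hB.1
          (Or.inl (hx.mem_alphaSet hn hx1.choose_spec.2)) (Or.inl (hx.mem_alphaSet hn hxs))
        rw [h3]
        rfl
      · have hx1 : ∃ B ∈ large ℓ 𝓑, x ∈ B.alphaCube n (eps n / 2) := ⟨B, hB, hxs.1⟩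
        rw [extend, if_neg hxs.2, dif_pos hx1]
        exact fineInterp_eq hn hN hx1.choose_spec.1 hB
          (hx.inter_nonempty hn hx1.choose_spec.2 hxs.1) _ _
      · have hx1 : ¬ ∃ B ∈ large ℓ 𝓑, x ∈ B.alphaCube n (eps n / 2) := fun h2 => hxs (Or.inr h2)
        rw [extend, if_neg fun h1 => hxs (Or.inl h1), dif_neg hx1]
        rfl

end Measurability

/-! ### Summation of the local bounds -/

section Main

/-- The constant in the bound for the squared error. -/
def errorConst (d : ℕ) (cβ cm : ℝ) : ℝ :=
  (3 / cβ + 2) * 9 ^ d + 2 * 16 ^ d * 6 ^ d * ((9 * d + 1) * cm ^ 2) *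
    ((2 * (⌈4 * cm⌉₊ + 2) + 1) ^ d : ℕ) * 9 ^ d

theorem errorConst_pos (d : ℕ) {cβ : ℝ} (hcβ : 0 < cβ) (cm : ℝ) : 0 < errorConst d cβ cm := by
  unfold errorConst
  positivity

/-- The gradient is seen at distance at most `ε/2 + 3h ≤ 4h ≤ 4cεℓ` from the `α`-cube, which is the
radius in the overlap count. -/
theorem tsum_localError_le {n L ℓ : ℕ} (hn : 0 < n) (hℓ : 0 < ℓ) {𝓑 : Set (Block d)}
    (h : IsTiling n L 𝓑) {cm : ℝ} (hcm : 0 < cm) {N : Block d → ℕ} (hN : IsMesh n ℓ 𝓑 cm N)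
    {u : (Fin d → ℝ) → ℝ} {g : Fin d → (Fin d → ℝ) → ℝ}
    (hu : IsH1Per u g) (hum : Measurable u) (hgm : ∀ k, Measurable (g k)) :
    ∑' B : large ℓ 𝓑, ∫⁻ x in unitCube d ∩ B.1.alphaCube n (eps n / 2), localError n N u g B.1 x ≤
      2 * 16 ^ d * (6 ^ d * (ENNReal.ofReal ((9 * d + 1) * (cm * (eps n * ℓ)) ^ 2) *
        (((2 * (⌈4 * cm⌉₊ + 2) + 1) ^ d : ℕ) * (9 ^ d * ∫⁻ x in unitCube d, gsq g x)))) := by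
  have he := eps_pos hn
  have hG := measurable_gsq hgm
  set T : large ℓ 𝓑 → Set (Fin d → ℝ) := fun B =>
    bigBox d ∩ B.1.alphaCube n (4 * cm * (eps n * ℓ)) with hTdef
  have hper : ∀ (m : Fin d → ℤ) x, gsq g (x + intVec m) = gsq g x := by
    intro m x
    simp only [gsq, hu.periodic_grad]
  have hB : ∀ B : large ℓ 𝓑, ∫⁻ x in unitCube d ∩ B.1.alphaCube n (eps n / 2),
      localError n N u g B.1 x ≤ 2 * 16 ^ d * (6 ^ d *
        (ENNReal.ofReal ((9 * d + 1) * (cm * (eps n * ℓ)) ^ 2) * ∫⁻ x in T B, gsq g x)) := by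
    intro B
    have h1 := hN.le_meshSize B.1 B.2
    have h2 := hN.meshSize_le B.1 B.2
    have hpos := he.trans_le h1
    have h3 : meshSize n N B.1 ≤ 1 := by
      refine le_trans ?_ (eps_mul_size_le_one hn h B.2.1)
      refine div_le_self (by positivity) ?_
      exact_mod_cast hN.pos B.1 B.2
    have hT : ∀ x ∈ unitCube d ∩ B.1.alphaCube n (eps n / 2), ∀ w : Fin d → ℝ,
        (∀ k, |w k| ≤ 3 * meshSize n N B.1) → x + w ∈ T B := by
      intro x hx w hw
      refine ⟨add_mem_bigBox hx.1 fun k => (hw k).trans (by linarith), fun k => ?_⟩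
      have i1 := hx.2 k
      have i2 := abs_le.1 (hw k)
      rw [Pi.add_apply]
      constructor <;> linarith [i1.1, i1.2, i2.1, i2.2]
    refine (setLIntegral_localError_le hu hum hgm hpos hT).trans ?_
    have h4 : (9 * d + 1) * meshSize n N B.1 ^ 2 ≤ (9 * d + 1) * (cm * (eps n * ℓ)) ^ 2 := by
      gcongr
    exact mul_le_mul_right (mul_le_mul_right (mul_le_mul_left (ENNReal.ofReal_le_ofReal h4) _) _) _
  refine (ENNReal.tsum_le_tsum hB).trans ?_
  rw [ENNReal.tsum_mul_left, ENNReal.tsum_mul_left, ENNReal.tsum_mul_left]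
  refine mul_le_mul_right (mul_le_mul_right (mul_le_mul_right ?_ _) _) _
  have hK : ∀ y, {B : large ℓ 𝓑 | y ∈ T B}.encard ≤ ((2 * (⌈4 * cm⌉₊ + 2) + 1) ^ d : ℕ) := by
    intro y
    refine le_trans ?_ (encard_large_le hn hℓ h (R := 4 * cm) (by positivity) y)
    exact Set.encard_le_encard_of_injOn (f := fun B : large ℓ 𝓑 => B.1)
      (fun B hB => ⟨B.2, hB.2⟩) Subtype.val_injective.injOn
  refine (tsum_setLIntegral_le (T := T) (S := bigBox d)
    (fun B => measurableSet_Icc.inter (isClosed_alphaCube n _ B.1).measurableSet)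
    (fun B => Set.inter_subset_left) hK hG).trans (mul_le_mul_right (setLIntegral_bigBox_le hper) _)

/-- A node within `2h` of `x` has its cube of radius `h` inside the cube of radius `3h` about `x`.
In the variable `w = y - x` the domain no longer depends on the node, which gives a single bound per
block. -/
theorem esq_sub_localProjection_le {n ℓ : ℕ} (hn : 0 < n) {𝓑 : Set (Block d)}
    {cm : ℝ} {N : Block d → ℕ} (hN : IsMesh n ℓ 𝓑 cm N) (S : SZChoice d)
    {u : (Fin d → ℝ) → ℝ} {g : Fin d → (Fin d → ℝ) → ℝ}
    (hu : IsH1Per u g) (hum : Measurable u) (hgm : ∀ k, Measurable (g k)) (x : Fin d → ℝ) :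
    esq (u x - localProjection n ℓ 𝓑 N S u g x) ≤
      (largeAlpha n ℓ 𝓑)ᶜ.indicator (fun x => esq (u x)) x +
      ∑' B : large ℓ 𝓑, (B.1.alphaCube n (eps n / 2)).indicator (localError n N u g B.1) x := by
  classical
  refine (esq_sub_extend_le hn hN _ x (u x) (fun B => localError n N u g B x) ?_).trans
    (add_le_add (le_of_eq ?_) (le_of_eq ?_))
  · intro B hB hxB B' hB' hsize i hi
    have hpos := (eps_pos hn).trans_le (hN.le_meshSize B hB)
    have hmem := node_mem_alphaCube (hN.pos B' hB') (hsize ▸ hpos) i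
    rw [szNodal, sizeAt_eq hN hB' hmem, hsize]
    refine (esq_sub_szFunctional_le hu hum hgm hpos _ _ _ _).trans ?_
    refine mul_le_mul_right (mul_le_mul_right ?_ _) _
    have h1 := setLIntegral_comp_add_le (f := fun w => esq (u (x + w) - u x) +
      ENNReal.ofReal (meshSize n N B ^ 2) * gsq g (x + w))
      (A := Set.Icc (fun k => node n N B' i k - meshSize n N B)
        fun k => node n N B' i k + meshSize n N B)
      (T := Set.Icc (fun _ => -(3 * meshSize n N B)) fun _ => 3 * meshSize n N B) (-x) ?_
    · refine le_trans (le_of_eq ?_) h1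
      refine lintegral_congr fun y => ?_
      rw [add_neg_cancel_comm_assoc, ← esq_neg, neg_sub]
    · intro y hy
      have h2 : ∀ k, -(3 * meshSize n N B) ≤ y k + -x k ∧ y k + -x k ≤ 3 * meshSize n N B := by
        intro k
        have i1 := hy.1 k
        have i2 := hy.2 k
        have i3 := abs_le.1 (hi k)
        simp only at i1 i2
        constructor <;> linarith [i3.1, i3.2]
      exact ⟨fun k => (h2 k).1, fun k => (h2 k).2⟩
  · by_cases hx : x ∈ largeAlpha n ℓ 𝓑 <;> simp [hx]
  · rw [← tsum_subtype_eq_of_support_subset (s := large ℓ 𝓑)]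
    · refine tsum_congr fun B => ?_
      by_cases hx : x ∈ B.1.alphaCube n (eps n / 2) <;> simp [hx, B.2]
    · intro B hB
      by_contra hB'
      exact hB (if_neg fun h1 => hB' h1.1)

theorem setLIntegral_tsum_indicator {ι : Type*} [Countable ι] {T : ι → Set (Fin d → ℝ)}
    {f : ι → (Fin d → ℝ) → ℝ≥0∞} (hT : ∀ i, MeasurableSet (T i)) (hf : ∀ i, Measurable (f i))
    (S : Set (Fin d → ℝ)) :
    ∫⁻ x in S, ∑' i, (T i).indicator (f i) x = ∑' i, ∫⁻ x in S ∩ T i, f i x := by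
  rw [lintegral_tsum fun i => ((hf i).indicator (hT i)).aemeasurable]
  refine tsum_congr fun i => ?_
  rw [lintegral_indicator (hT i), Measure.restrict_restrict (hT i), Set.inter_comm]

theorem lintegral_sub_localProjection_le {n L ℓ : ℕ} (hn : 0 < n) (hℓ : 0 < ℓ)
    {𝓑 : Set (Block d)} (h : IsTiling n L 𝓑) {α β cβ cm : ℝ} (hα : 0 ≤ α) (hαβ : α ≤ β)
    (hcβ : 0 < cβ) (hβ : cβ * (eps n ^ 2)⁻¹ ≤ β) (hcm : 0 < cm) {N : Block d → ℕ}
    (hN : IsMesh n ℓ 𝓑 cm N) (S : SZChoice d)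
    {u : (Fin d → ℝ) → ℝ} {g : Fin d → (Fin d → ℝ) → ℝ}
    (hu : IsH1Per u g) (hum : Measurable u) (hgm : ∀ k, Measurable (g k)) :
    ∫⁻ x in unitCube d, esq (u x - localProjection n ℓ 𝓑 N S u g x) ≤
      ENNReal.ofReal (errorConst d cβ cm * (eps n * ℓ) ^ 2) *
        ∫⁻ x in unitCube d, energyDensity (potential n 𝓑 α β) u g x := by
  have he := eps_pos hn
  have hla := measurableSet_largeAlpha n ℓ 𝓑
  set E := ∫⁻ x in unitCube d, energyDensity (potential n 𝓑 α β) u g x with hE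
  have hgE : ∫⁻ x in unitCube d, gsq g x ≤ E :=
    lintegral_mono fun x => gsq_le_energyDensity (potential_nonneg n 𝓑 hα hαβ x)
  have h1 : ∫⁻ x in unitCube d, (largeAlpha n ℓ 𝓑)ᶜ.indicator (fun x => esq (u x)) x ≤
      ENNReal.ofReal ((3 / cβ + 2) * (eps n * ℓ) ^ 2) * (9 ^ d * E) := by
    rw [lintegral_indicator hla.compl, Measure.restrict_restrict hla.compl, Set.inter_comm]
    exact lintegral_compl_largeAlpha_le hn hℓ h hα hαβ hcβ hβ hu hum hgm
  have h2 : ∫⁻ x in unitCube d, ∑' B : large ℓ 𝓑,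
      (B.1.alphaCube n (eps n / 2)).indicator (localError n N u g B.1) x ≤
      2 * 16 ^ d * (6 ^ d * (ENNReal.ofReal ((9 * d + 1) * (cm * (eps n * ℓ)) ^ 2) *
        (((2 * (⌈4 * cm⌉₊ + 2) + 1) ^ d : ℕ) * (9 ^ d * E)))) := by
    rw [setLIntegral_tsum_indicator
      (T := fun B : large ℓ 𝓑 => B.1.alphaCube n (eps n / 2))
      (f := fun B : large ℓ 𝓑 => localError n N u g B.1)
      (fun B => (isClosed_alphaCube n _ B.1).measurableSet)
      (fun B => measurable_localError n N hum hgm B.1)]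
    refine (tsum_localError_le hn hℓ h hcm hN hu hum hgm).trans ?_
    gcongr
  have hm : Measurable ((largeAlpha n ℓ 𝓑)ᶜ.indicator fun x => esq (u x)) :=
    (measurable_esq.comp hum).indicator hla.compl
  calc _ ≤ ∫⁻ x in unitCube d, ((largeAlpha n ℓ 𝓑)ᶜ.indicator (fun x => esq (u x)) x +
        ∑' B : large ℓ 𝓑, (B.1.alphaCube n (eps n / 2)).indicator (localError n N u g B.1) x) :=
        lintegral_mono fun x => esq_sub_localProjection_le hn hN S hu hum hgm x
    _ ≤ _ := (lintegral_add_left hm _).le.trans (add_le_add h1 h2)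
    _ = _ := by
        have e9 : (9 : ℝ≥0∞) ^ d = ENNReal.ofReal (9 ^ d) := by
          rw [ENNReal.ofReal_pow (by norm_num)]; norm_num
        have e16 : (16 : ℝ≥0∞) ^ d = ENNReal.ofReal (16 ^ d) := by
          rw [ENNReal.ofReal_pow (by norm_num)]; norm_num
        have e6 : (6 : ℝ≥0∞) ^ d = ENNReal.ofReal (6 ^ d) := by
          rw [ENNReal.ofReal_pow (by norm_num)]; norm_num
        have e2 : (2 : ℝ≥0∞) = ENNReal.ofReal 2 := by norm_num
        rw [← ENNReal.ofReal_natCast, e9, e16, e6, e2]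
        simp only [← mul_assoc]
        rw [← ENNReal.ofReal_mul (by positivity), ← ENNReal.ofReal_mul (by positivity),
          ← ENNReal.ofReal_mul (by positivity), ← ENNReal.ofReal_mul (by positivity),
          ← ENNReal.ofReal_mul (by positivity), ← ENNReal.ofReal_mul (by positivity), ← add_mul,
          ← ENNReal.ofReal_add (by positivity) (by positivity)]
        congr 2
        unfold errorConst
        ring

end Main

/-! ### Passage to Borel representatives and to real norms -/

section Conclusion

/-- Nodal values are integrals, so null sets do not matter; the projections agree everywhere, not
only almost everywhere. -/
theorem localProjection_congr {n ℓ : ℕ} (hn : 0 < n) {𝓑 : Set (Block d)} {cm : ℝ}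
    {N : Block d → ℕ} (hN : IsMesh n ℓ 𝓑 cm N) (S : SZChoice d) {u u' : (Fin d → ℝ) → ℝ}
    {g g' : Fin d → (Fin d → ℝ) → ℝ} (hu : u =ᵐ[volume] u') (hg : ∀ k, g k =ᵐ[volume] g' k) :
    localProjection n ℓ 𝓑 N S u g = localProjection n ℓ 𝓑 N S u' g' := by
  have h : q1Large n ℓ 𝓑 N (szNodal n ℓ 𝓑 N S u g) = q1Large n ℓ 𝓑 N (szNodal n ℓ 𝓑 N S u' g') := by
    ext x
    rw [q1Large, q1Large]
    split_ifs with hx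
    · obtain ⟨hB, -⟩ := hx.choose_spec
      have hpos := (eps_pos hn).trans_le (hN.le_meshSize _ hB)
      refine Finset.sum_congr rfl fun i _ => ?_
      congr 1
      have hmem := node_mem_alphaCube (hN.pos _ hB) hpos i
      rw [szNodal, szNodal, sizeAt_eq hN hB hmem]
      exact szFunctional_congr hu hg hpos _ _ _
    · rfl
  ext x
  simp only [localProjection, extend, h]

theorem integrable_energy (n : ℕ) (𝓑 : Set (Block d)) {α β : ℝ} (hα : 0 ≤ α) (hαβ : α ≤ β)
    {u : (Fin d → ℝ) → ℝ} {g : Fin d → (Fin d → ℝ) → ℝ} (hu : IsH1Per u g) :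
    Integrable (fun x => (∑ k, g k x ^ 2) + potential n 𝓑 α β x * u x ^ 2)
      (volume.restrict (unitCube d)) := by
  refine (integrable_finsetSum _ fun k _ => (hu.memLp_grad k).integrable_sq).add ?_
  refine hu.memLp.integrable_sq.bdd_mul (c := β)
    (measurable_potential n 𝓑 α β).aestronglyMeasurable (Filter.Eventually.of_forall fun x => ?_)
  rw [Real.norm_of_nonneg (potential_nonneg n 𝓑 hα hαβ x)]
  exact potential_le n 𝓑 hαβ x

theorem localProjection_error_le {n L ℓ : ℕ} (hn : 0 < n) (hℓ : 0 < ℓ)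
    {𝓑 : Set (Block d)} (h : IsTiling n L 𝓑) {α β cβ cm : ℝ} (hα : 0 ≤ α) (hαβ : α ≤ β)
    (hcβ : 0 < cβ) (hβ : cβ * (eps n ^ 2)⁻¹ ≤ β) (hcm : 0 < cm) {N : Block d → ℕ}
    (hN : IsMesh n ℓ 𝓑 cm N) (S : SZChoice d)
    {u : (Fin d → ℝ) → ℝ} {g : Fin d → (Fin d → ℝ) → ℝ} (hu : IsH1Per u g) :
    MemLp (fun x => u x - localProjection n ℓ 𝓑 N S u g x) 2 (volume.restrict (unitCube d)) ∧
      l2Norm (fun x => u x - localProjection n ℓ 𝓑 N S u g x) ≤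
        √(errorConst d cβ cm) * (eps n * ℓ) * energyNorm (potential n 𝓑 α β) u g := by
  obtain ⟨u', g', hu', hum, hgm, huu, hgg⟩ := hu.exists_measurable
  have he := eps_pos hn
  have hK := errorConst_pos d hcβ cm
  set V := potential n 𝓑 α β with hV
  set w : (Fin d → ℝ) → ℝ := fun x => u x - localProjection n ℓ 𝓑 N S u g x with hw
  have hVn : ∀ x, 0 ≤ V x := potential_nonneg n 𝓑 hα hαβ
  have hen : ∀ x, 0 ≤ (∑ k, g' k x ^ 2) + V x * u' x ^ 2 := fun x =>
    add_nonneg (Finset.sum_nonneg fun _ _ => sq_nonneg _) (mul_nonneg (hVn x) (sq_nonneg _))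
  have hint := integrable_energy n 𝓑 hα hαβ hu'
  have hE : ENNReal.ofReal (∫ x in unitCube d, ((∑ k, g k x ^ 2) + V x * u x ^ 2)) =
      ∫⁻ x in unitCube d, energyDensity V u' g' x := by
    have e : ∫ x in unitCube d, ((∑ k, g k x ^ 2) + V x * u x ^ 2) =
        ∫ x in unitCube d, ((∑ k, g' k x ^ 2) + V x * u' x ^ 2) := by
      refine integral_congr_ae (ae_restrict_of_ae ?_)
      filter_upwards [huu, ae_all_iff.2 hgg] with x hx hgx
      simp only [hx, hgx]
    rw [e, ofReal_integral_eq_lintegral_ofReal hint (Filter.Eventually.of_forall hen)]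
    rfl
  -- Finiteness of this bound gives membership in `L²(D)` and, after a square root, the norm
  -- estimate.
  have hwle : ∫⁻ x in unitCube d, esq (w x) ≤ ENNReal.ofReal
      (errorConst d cβ cm * (eps n * ℓ) ^ 2 *
        ∫ x in unitCube d, ((∑ k, g k x ^ 2) + V x * u x ^ 2)) := by
    have e : ∫⁻ x in unitCube d, esq (w x) =
        ∫⁻ x in unitCube d, esq (u' x - localProjection n ℓ 𝓑 N S u' g' x) := by
      refine lintegral_congr_ae (ae_restrict_of_ae ?_)
      filter_upwards [huu] with x hx
      simp only [hw, hx, localProjection_congr hn hN S huu hgg]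
    rw [e, ENNReal.ofReal_mul (by positivity), hE]
    exact lintegral_sub_localProjection_le hn hℓ h hα hαβ hcβ hβ hcm hN S hu' hum hgm
  have hwm : AEStronglyMeasurable w (volume.restrict (unitCube d)) :=
    hu.memLp.1.sub (aemeasurable_extend hn h hN _).restrict.aestronglyMeasurable
  have hmem : MemLp w 2 (volume.restrict (unitCube d)) := by
    refine ⟨hwm, ?_⟩
    rw [eLpNorm_lt_top_iff_lintegral_rpow_enorm_lt_top two_ne_zero ENNReal.ofNat_ne_top]
    refine lt_of_le_of_lt (le_of_eq ?_) (hwle.trans_lt ENNReal.ofReal_lt_top)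
    simp [esq_eq_enorm]
  refine ⟨hmem, ?_⟩
  have hE0 : 0 ≤ ∫ x in unitCube d, ((∑ k, g k x ^ 2) + V x * u x ^ 2) :=
    integral_nonneg fun x =>
      add_nonneg (Finset.sum_nonneg fun _ _ => sq_nonneg _) (mul_nonneg (hVn x) (sq_nonneg _))
  have hsq : ∫ x in unitCube d, w x ^ 2 ≤ errorConst d cβ cm * (eps n * ℓ) ^ 2 *
      ∫ x in unitCube d, ((∑ k, g k x ^ 2) + V x * u x ^ 2) := by
    refine (ENNReal.ofReal_le_ofReal_iff (by positivity)).1 ?_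
    rw [ofReal_integral_eq_lintegral_ofReal hmem.integrable_sq
      (Filter.Eventually.of_forall fun x => sq_nonneg _)]
    exact hwle
  rw [l2Norm, energyNorm]
  refine (Real.sqrt_le_sqrt hsq).trans (le_of_eq ?_)
  rw [Real.sqrt_mul (by positivity), Real.sqrt_mul hK.le, Real.sqrt_sq (by positivity)]

end Conclusion

end Domino

end

theorem mainTheorem7 (d : ℕ) (cβ cmesh : ℝ) (hcβ : 0 < cβ) (hcmesh : 0 < cmesh) :
    ∃ C : ℝ, 0 < C ∧
      ∀ (n L ℓ : ℕ) (α β : ℝ), 0 < n → 1 < ℓ → ℓ < L → 0 ≤ α → α ≤ β →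
        cβ * ((Domino.eps n) ^ 2)⁻¹ ≤ β →
      ∀ 𝓑 : Set (Domino.Block d), Domino.IsTiling n L 𝓑 →
      ∀ N : Domino.Block d → ℕ, Domino.IsMesh n ℓ 𝓑 cmesh N →
      ∀ S : Domino.SZChoice d, S.IsAdmissible n ℓ 𝓑 N →
      ∀ (u : (Fin d → ℝ) → ℝ) (g : Fin d → (Fin d → ℝ) → ℝ), Domino.IsH1Per u g →
        MeasureTheory.MemLp (fun x => u x - Domino.localProjection n ℓ 𝓑 N S u g x) 2
            (MeasureTheory.volume.restrict (Domino.unitCube d)) ∧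
          Domino.l2Norm (fun x => u x - Domino.localProjection n ℓ 𝓑 N S u g x) ≤
            C * (Domino.eps n * ℓ) * Domino.energyNorm (Domino.potential n 𝓑 α β) u g := by
  refine ⟨√(Domino.errorConst d cβ cmesh), Real.sqrt_pos.2 (Domino.errorConst_pos d hcβ cmesh), ?_⟩
  intro n L ℓ α β hn hℓ _ hα hαβ hβ 𝓑 h𝓑 N hN S _ u g hu
  exact Domino.localProjection_error_le hn (by omega) h𝓑 hα hαβ hcβ hβ hcmesh hN S hu
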